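/- Let $M$ be a normal complex $N\times N$ matrix whose eigenvalues $z_1,\dots,z_N$ (listed with algebraic multiplicity) are distinct. Write $W(M)=\{(Mu,u): u\in\mathbb C^N,\ \|u\|=1\}$ for its numerical range and $\Lambda_2(M)$ for its rank-2 numerical range, i.e. the set of those $\lambda\in\mathbb C$ such that $PMP=\lambda P$ for some orthogonal projection $P$ of rank $2$. If every $z_j$ is an extreme point of $W(M)$, then for all $a,b\in\Lambda_2(M)$ the matrix $\begin{bmatrix}a&0\\0&b\end{bmatrix}$ is a compression of $M$, i.e. it is the upper left $2\times 2$ corner of $UMU^*$ for some unitary $U$. Moreover, if $M$ is unitary (with distinct eigenvalues), then every $z_j$ is an extreme point of $W(M)$, so that the conclusion holds. -/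

import Mathlib

open scoped Matrix

namespace NormalCompression

/-- The (classical) numerical range `W(M) = {(Mu, u) : ‖u‖ = 1}` of a complex matrix. -/
def numericalRange {N : ℕ} (M : Matrix (Fin N) (Fin N) ℂ) : Set ℂ :=
  {c | ∃ u : EuclideanSpace ℂ (Fin N), ‖u‖ = 1 ∧ c = star u.ofLp ⬝ᵥ (M *ᵥ u.ofLp)}

/-- The rank-`k` numerical range `Λ_k(M)`: all `c` such that `P M P = c P` for some orthogonal
projection `P` of rank `k`. -/
def rankNumericalRange {N : ℕ} (k : ℕ) (M : Matrix (Fin N) (Fin N) ℂ) : Set ℂ :=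
  {c | ∃ P : Matrix (Fin N) (Fin N) ℂ,
    P.IsHermitian ∧ P * P = P ∧ P.rank = k ∧ P * M * P = c • P}

/-- `C` is a (rank-`k`) compression of `M`: it is the upper left `k × k` corner of `U M U*` for
some unitary matrix `U`. -/
def IsCompression {N k : ℕ} (C : Matrix (Fin k) (Fin k) ℂ) (M : Matrix (Fin N) (Fin N) ℂ) : Prop :=
  ∃ h : k ≤ N, ∃ U ∈ Matrix.unitaryGroup (Fin N) ℂ,
    C = (U * M * Uᴴ).submatrix (Fin.castLE h) (Fin.castLE h)

end NormalCompression

/-! In an orthonormal eigenbasis $M$ is $\mathrm{diag}(z_j)$, and $W(M)$ is the convex hull of the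
$z_j$. Since every $z_j$ is extreme, the $z_j$ are the vertices of a strictly convex polygon
(`exists_perm_convexPosition`). A two-dimensional subspace contains a nonzero vector with any
prescribed coordinate zero, so every point of $\Lambda_2(M)$ is `Deep`: it survives the removal of
any vertex (`deep_of_mem_rankNumericalRange`). It remains to represent deep points $a,b$ by convex
weights $p,q$ on the vertices for which $x_j=\sqrt{p_j}$ and $y_j=\pm\sqrt{q_j}$ satisfy $\sum
x_jy_j=0$ and $\sum x_jy_jz_j=0$.

The easy way is to give $p$ and $q$ disjoint supports. A half-plane that contains a deep point
contains at least two vertices, and it cannot separate crossing diagonals; so a vertex set $S$ whose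
hull misses the point must leave some two outside vertices adjacent around $S$ (`Deep.exists_cut`).
For even $N$, alternate vertices serve $a$ and $b$. For odd $N\ge 7$ one adjacent pair must be left
unseparated, and it is placed away from a triangle of vertices containing $a$
(`ConvexPosition.diagCompression_of_pair`). For $N=1,3$ there are no deep points.

The pentagon needs overlapping supports, unless $b$ lies on one of three diagonals. With $c$ the
affine dependence of four vertices, $p_jq_j\propto c_j^2$ allows $x_jy_j\propto c_j$. Moving $p$
along a segment of representations of $b$ sweeps the point of $q$ from one vertex to another, and
the intermediate value theorem aligns it with the fifth vertex and $a$
(`ConvexPosition.diagCompression_five_of_pos`). -/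

namespace NormalCompression

/-! ### Signed areas and convex weights -/

/-- Twice the signed area of the triangle `a b c`. -/
def orient (a b c : ℂ) : ℝ := (b.re - a.re) * (c.im - a.im) - (b.im - a.im) * (c.re - a.re)

lemma orient_rotate (a b c : ℂ) : orient b c a = orient a b c := by
  unfold orient; ring

lemma orient_swap (a b c : ℂ) : orient b a c = -orient a b c := by
  unfold orient; ring

/-- The weights live on all of `ι`, so that weights supported on different sets can be multiplied
index by index. -/
lemma mem_convexHull_image_iff {ι : Type*} [Fintype ι] (z : ι → ℂ) (S : Set ι) (a : ℂ) :
    a ∈ convexHull ℝ (z '' S) ↔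
      ∃ p : ι → ℝ, (∀ i, 0 ≤ p i) ∧ (∀ i, i ∉ S → p i = 0) ∧ ∑ i, p i = 1 ∧
        ∑ i, p i • z i = a := by
  classical
  constructor
  · intro h
    have hsub : convexHull ℝ (z '' S) ⊆ {a | ∃ p : ι → ℝ, (∀ i, 0 ≤ p i) ∧
        (∀ i, i ∉ S → p i = 0) ∧ ∑ i, p i = 1 ∧ ∑ i, p i • z i = a} := by
      apply convexHull_min
      · rintro _ ⟨i, hi, rfl⟩
        refine ⟨Pi.single i 1, fun j => ?_, fun j hj => ?_, by simp, ?_⟩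
        · by_cases h : j = i
          · subst h; simp
          · simp [h]
        · have : j ≠ i := fun h => hj (h ▸ hi)
          simp [this]
        · simp [Pi.single_apply, ite_smul]
      · rintro _ ⟨p, hp, hpS, hp1, rfl⟩ _ ⟨q, hq, hqS, hq1, rfl⟩ s t hs ht hst
        refine ⟨fun i => s * p i + t * q i, fun i => ?_, fun i hi => ?_, ?_, ?_⟩
        · have := hp i; have := hq i; positivity
        · simp [hpS i hi, hqS i hi]
        · rw [Finset.sum_add_distrib, ← Finset.mul_sum, ← Finset.mul_sum, hp1, hq1]; linarith
        · simp only [add_smul, mul_smul, Finset.sum_add_distrib, Finset.smul_sum]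
    exact hsub h
  · rintro ⟨p, hp, hpS, hp1, rfl⟩
    rw [← Finset.sum_filter_add_sum_filter_not Finset.univ (· ∈ S)] at hp1 ⊢
    rw [Finset.sum_eq_zero (s := Finset.univ.filter (¬ · ∈ S))] at hp1 ⊢
    · rw [add_zero] at hp1 ⊢
      exact (convex_convexHull ℝ _).sum_mem (fun i _ => hp i) hp1
        fun i hi => subset_convexHull _ _ ⟨i, (Finset.mem_filter.1 hi).2, rfl⟩
    · intro i hi; rw [hpS i (Finset.mem_filter.1 hi).2, zero_smul]
    · intro i hi; exact hpS i (Finset.mem_filter.1 hi).2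

/-- The signed area is affine in its last argument. -/
lemma orient_sum {ι : Type*} [Fintype ι] (z : ι → ℂ) (p : ι → ℝ) (hp : ∑ i, p i = 1) (u v : ℂ) :
    orient u v (∑ i, p i • z i) = ∑ i, p i * orient u v (z i) := by
  have hre : (∑ i, p i • z i).re = ∑ i, p i * (z i).re := by simp
  have him : (∑ i, p i • z i).im = ∑ i, p i * (z i).im := by simp
  have h : ∀ i, p i * orient u v (z i) = (v.re - u.re) * (p i * (z i).im)
      - (v.im - u.im) * (p i * (z i).re)
      + ((v.im - u.im) * u.re - (v.re - u.re) * u.im) * p i := fun i => by unfold orient; ring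
  simp only [h, Finset.sum_add_distrib, Finset.sum_sub_distrib, ← Finset.mul_sum, hp]
  unfold orient
  rw [hre, him]; ring

lemma orient_nonneg_of_mem_convexHull {ι : Type*} [Fintype ι] {z : ι → ℂ} {S : Set ι} {a u v : ℂ}
    (ha : a ∈ convexHull ℝ (z '' S)) (h : ∀ i ∈ S, 0 ≤ orient u v (z i)) : 0 ≤ orient u v a := by
  obtain ⟨p, hp, hpS, hp1, rfl⟩ := (mem_convexHull_image_iff z S a).1 ha
  rw [orient_sum z p hp1]
  refine Finset.sum_nonneg fun i _ => ?_
  by_cases hi : i ∈ S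
  · exact mul_nonneg (hp i) (h i hi)
  · simp [hpS i hi]

/-- The barycentric coordinates of a point with respect to a triangle, cleared of denominators. -/
lemma orient_barycentric (u v w a : ℂ) :
    orient u v w • a = orient v w a • u + orient w u a • v + orient u v a • w := by
  apply Complex.ext <;> simp [orient] <;> ring

lemma orient_sum_barycentric (u v w a : ℂ) :
    orient v w a + orient w u a + orient u v a = orient u v w := by
  unfold orient; ring

lemma barycentric_mem_convexHull {s : Set ℂ} {u v w a : ℂ} (hu : u ∈ s) (hv : v ∈ s) (hw : w ∈ s)
    (h : 0 < orient u v w) (h1 : 0 ≤ orient v w a) (h2 : 0 ≤ orient w u a)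
    (h3 : 0 ≤ orient u v a) : a ∈ convexHull ℝ s := by
  have key : a = (orient v w a / orient u v w) • u + (orient w u a / orient u v w) • v
      + (orient u v a / orient u v w) • w := by
    have := congrArg (fun x => (orient u v w)⁻¹ • x) (orient_barycentric u v w a)
    simp only [smul_add, smul_smul, inv_mul_cancel₀ h.ne', one_smul] at this
    simp only [div_eq_inv_mul]
    exact this
  have hc := convex_convexHull ℝ s
  have hsum : orient v w a / orient u v w + orient w u a / orient u v w
      + orient u v a / orient u v w = 1 := by
    rw [← add_div, ← add_div, orient_sum_barycentric, div_self h.ne']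
  rw [key]
  have := hc.sum_mem (t := Finset.univ) (w := ![orient v w a / orient u v w,
    orient w u a / orient u v w, orient u v a / orient u v w]) (z := ![u, v, w])
    (by intro i _; fin_cases i <;> simp <;> positivity)
    (by simpa [Fin.sum_univ_three] using hsum)
    (by intro i _; fin_cases i <;> simp <;> apply subset_convexHull <;> assumption)
  simpa [Fin.sum_univ_three] using this

/-! ### Convex polygons, half-planes and deep points -/

/-- `z` lists the vertices of a strictly convex polygon counterclockwise. -/
def ConvexPosition {N : ℕ} (z : Fin N → ℂ) : Prop :=
  ∀ i j k, i < j → j < k → 0 < orient (z i) (z j) (z k)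

/-- A half-plane cannot separate the diagonals of a convex quadrilateral. -/
lemma ConvexPosition.not_separated {N : ℕ} {z : Fin N → ℂ} (hz : ConvexPosition z)
    {i j k l : Fin N} (hij : i < j) (hjk : j < k) (hkl : k < l) (f : ℂ →L[ℝ] ℝ) (c : ℝ)
    (hi : f (z i) < c) (hk : f (z k) < c) (hj : c < f (z j)) (hl : c < f (z l)) : False := by
  have h1 := hz j k l hjk hkl
  have h2 := hz i j l hij (hjk.trans hkl)
  have h3 := hz i k l (hij.trans hjk) hkl
  have h4 := hz i j k hij hjk
  -- The crossing point of the diagonals, denominators cleared: a positive combination of `z i`, `z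
  -- k` equals one of `z j`, `z l` with the same total weight.
  have e : orient (z j) (z k) (z l) • z i + orient (z i) (z j) (z l) • z k
      = orient (z i) (z k) (z l) • z j + orient (z i) (z j) (z k) • z l := by
    apply Complex.ext <;> simp [orient] <;> ring
  have e' : orient (z j) (z k) (z l) + orient (z i) (z j) (z l)
      = orient (z i) (z k) (z l) + orient (z i) (z j) (z k) := by
    unfold orient; ring
  have := congrArg f e
  simp only [map_add, map_smul, smul_eq_mul] at this
  have ec := congrArg (· * c) e'
  simp only [add_mul] at ec
  linarith [mul_lt_mul_of_pos_left hi h1, mul_lt_mul_of_pos_left hk h2,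
    mul_lt_mul_of_pos_left hj h3, mul_lt_mul_of_pos_left hl h4]

lemma not_mem_convexHull_separation {ι : Type*} [Finite ι] {z : ι → ℂ} {S : Set ι} {a : ℂ}
    (ha : a ∉ convexHull ℝ (z '' S)) :
    ∃ (f : ℂ →L[ℝ] ℝ) (c : ℝ), f a < c ∧ ∀ s ∈ S, c < f (z s) := by
  have hcl : IsClosed (convexHull ℝ (z '' S)) :=
    ((S.toFinite.image z).isCompact_convexHull (𝕜 := ℝ)).isClosed
  obtain ⟨f, c, h1, h2⟩ := geometric_hahn_banach_point_closed (convex_convexHull ℝ _) hcl ha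
  exact ⟨f, c, h1, fun s hs => h2 _ (subset_convexHull _ _ ⟨s, hs, rfl⟩)⟩

lemma exists_lt_of_mem_convexHull {ι : Type*} {z : ι → ℂ} {S : Set ι} {a : ℂ}
    (ha : a ∈ convexHull ℝ (z '' S)) (f : ℂ →L[ℝ] ℝ) {c : ℝ} (h : f a < c) :
    ∃ s ∈ S, f (z s) < c := by
  by_contra! hcon
  have : convexHull ℝ (z '' S) ⊆ {x | c ≤ f x} := by
    apply convexHull_min
    · rintro _ ⟨i, hi, rfl⟩; exact hcon i hi
    · exact convex_halfSpace_ge f.toLinearMap.isLinear c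
  exact absurd (this ha) (not_le.2 h)

/-- `a` stays in the polygon with vertices `z` after any one vertex is removed. -/
def Deep {ι : Type*} (z : ι → ℂ) (a : ℂ) : Prop := ∀ j, a ∈ convexHull ℝ (z '' {j}ᶜ)

/-- If a deep point is not in the hull of the vertices in `S`, then a half-plane cuts off two
vertices outside `S` which `S` does not separate. -/
lemma Deep.exists_cut {N : ℕ} {z : Fin N → ℂ} (hz : ConvexPosition z) (hN : 0 < N) {a : ℂ}
    (ha : Deep z a) {S : Set (Fin N)} (h : a ∉ convexHull ℝ (z '' S)) :
    ∃ (f : ℂ →L[ℝ] ℝ) (c : ℝ), f a < c ∧ (∀ s ∈ S, c < f (z s)) ∧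
      ∃ j k, j < k ∧ j ∉ S ∧ k ∉ S ∧ f (z j) < c ∧ f (z k) < c ∧
        ¬ ∃ s ∈ S, ∃ t ∈ S, (j < s ∧ s < k) ∧ (t < j ∨ k < t) := by
  obtain ⟨f, c, hfa, hfS⟩ := not_mem_convexHull_separation h
  refine ⟨f, c, hfa, hfS, ?_⟩
  -- Deepness at any vertex gives one vertex in the half-plane; deepness at that vertex gives a
  -- second.
  obtain ⟨j, -, hj⟩ := exists_lt_of_mem_convexHull (ha ⟨0, hN⟩) f hfa
  obtain ⟨k, hkj, hk⟩ := exists_lt_of_mem_convexHull (ha j) f hfa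
  have aux : ∀ {j k}, f (z j) < c → f (z k) < c → j < k → ∃ j k, j < k ∧ j ∉ S ∧ k ∉ S ∧
      f (z j) < c ∧ f (z k) < c ∧ ¬ ∃ s ∈ S, ∃ t ∈ S, (j < s ∧ s < k) ∧ (t < j ∨ k < t) := by
    intro j k hj hk hjk
    refine ⟨j, k, hjk, fun h => (hfS j h).not_gt hj, fun h => (hfS k h).not_gt hk, hj, hk, ?_⟩
    rintro ⟨s, hs, t, ht, ⟨h1, h2⟩, h3 | h3⟩
    -- In the cyclic order `t < j < s < k` the pair from `S` comes first, hence the change of sign.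
    · refine hz.not_separated h3 h1 h2 (-f) (-c) ?_ ?_ ?_ ?_ <;> simp <;>
        first | assumption | (apply hfS; assumption)
    · exact hz.not_separated h1 h2 h3 f c hj hk (hfS s hs) (hfS t ht)
  rcases lt_or_gt_of_ne (show k ≠ j from hkj) with h | h
  · exact aux hk hj h
  · exact aux hj hk h

lemma Deep.mem_convexHull {N : ℕ} {z : Fin N → ℂ} (hz : ConvexPosition z) (hN : 0 < N) {a : ℂ}
    (ha : Deep z a) {S : Set (Fin N)}
    (hS : ∀ j k, j < k → j ∉ S → k ∉ S → ∃ s ∈ S, ∃ t ∈ S, (j < s ∧ s < k) ∧ (t < j ∨ k < t)) :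
    a ∈ convexHull ℝ (z '' S) := by
  by_contra h
  obtain ⟨f, c, -, -, j, k, hjk, hj, hk, -, -, hno⟩ := ha.exists_cut hz hN h
  exact hno (hS j k hjk hj hk)

/-! ### Compressions from convex weights -/

/-- The existence of real orthonormal vectors `x`, `y` such that `diag z` compresses to `diag(a,b)`
on their span. -/
def DiagCompression {ι : Type*} [Fintype ι] (z : ι → ℂ) (a b : ℂ) : Prop :=
  ∃ x y : ι → ℝ, ∑ i, x i ^ 2 = 1 ∧ ∑ i, x i ^ 2 • z i = a ∧ ∑ i, y i ^ 2 = 1 ∧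
    ∑ i, y i ^ 2 • z i = b ∧ ∑ i, x i * y i = 0 ∧ ∑ i, (x i * y i) • z i = 0

lemma DiagCompression.symm {ι : Type*} [Fintype ι] {z : ι → ℂ} {a b : ℂ}
    (h : DiagCompression z a b) : DiagCompression z b a := by
  obtain ⟨x, y, h1, h2, h3, h4, h5, h6⟩ := h
  exact ⟨y, x, h3, h4, h1, h2, by simpa only [mul_comm] using h5, by simpa only [mul_comm] using h6⟩

/-- Take square roots of the weights and give the second vector the signs of `w`; the coordinatewise
product is then `w` itself. -/
lemma diagCompression_of_weights {ι : Type*} [Fintype ι] (z : ι → ℂ) {a b : ℂ} (p q w : ι → ℝ)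
    (hp : ∀ i, 0 ≤ p i) (hq : ∀ i, 0 ≤ q i) (hp1 : ∑ i, p i = 1) (hq1 : ∑ i, q i = 1)
    (ha : ∑ i, p i • z i = a) (hb : ∑ i, q i • z i = b) (hw : ∀ i, p i * q i = w i ^ 2)
    (hw0 : ∑ i, w i = 0) (hwz : ∑ i, w i • z i = 0) : DiagCompression z a b := by
  have hmul : ∀ i, √(p i) * (if 0 ≤ w i then √(q i) else -√(q i)) = w i := by
    intro i
    have h : √(p i) * √(q i) = |w i| := by
      rw [← Real.sqrt_mul (hp i), hw, Real.sqrt_sq_eq_abs]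
    split_ifs with h0
    · rw [h, abs_of_nonneg h0]
    · rw [mul_neg, h, abs_of_neg (not_le.1 h0), neg_neg]
  have hsq : ∀ i, (if 0 ≤ w i then √(q i) else -√(q i)) ^ 2 = q i := by
    intro i; split_ifs <;> simp [Real.sq_sqrt (hq i)]
  refine ⟨fun i => √(p i), fun i => if 0 ≤ w i then √(q i) else -√(q i), ?_⟩
  simp only [hmul, hsq, Real.sq_sqrt (hp _)]
  exact ⟨hp1, ha, hq1, hb, hw0, hwz⟩

lemma diagCompression_of_disjoint {ι : Type*} [Fintype ι] (z : ι → ℂ) {a b : ℂ} (S T : Set ι)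
    (hST : ∀ i ∈ S, i ∉ T) (ha : a ∈ convexHull ℝ (z '' S)) (hb : b ∈ convexHull ℝ (z '' T)) :
    DiagCompression z a b := by
  obtain ⟨p, hp, hpS, hp1, hpa⟩ := (mem_convexHull_image_iff z S a).1 ha
  obtain ⟨q, hq, hqT, hq1, hqb⟩ := (mem_convexHull_image_iff z T b).1 hb
  refine diagCompression_of_weights z p q 0 hp hq hp1 hq1 hpa hqb (fun i => ?_) (by simp) (by simp)
  by_cases hi : i ∈ S
  · simp [hqT i (hST i hi)]
  · simp [hpS i hi]

/-! ### Even polygons, and odd polygons with at least seven vertices -/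

lemma ConvexPosition.diagCompression_even {N : ℕ} {z : Fin N → ℂ} (hz : ConvexPosition z)
    (hN : 0 < N) (hev : N % 2 = 0) {a b : ℂ} (ha : Deep z a) (hb : Deep z b) :
    DiagCompression z a b := by
  refine diagCompression_of_disjoint z {i | i.val % 2 = 0} {i | i.val % 2 = 1}
    (fun i hi hi' => ?_) (ha.mem_convexHull hz hN ?_) (hb.mem_convexHull hz hN ?_)
  · simp only [Set.mem_ofPred_eq] at hi hi'; omega
  · intro j k hjk hj hk
    simp only [Set.mem_ofPred_eq, Fin.lt_def] at *
    exact ⟨⟨j + 1, by omega⟩, by dsimp only; omega, ⟨0, hN⟩, by simp, by dsimp only; omega,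
      by dsimp only; omega⟩
  · intro j k hjk hj hk
    simp only [Set.mem_ofPred_eq, Fin.lt_def] at *
    exact ⟨⟨j + 1, by omega⟩, by dsimp only; omega, ⟨N - 1, by omega⟩, by dsimp only; omega,
      by dsimp only; omega, by dsimp only; omega⟩

/-- Fan triangulation of a convex polygon from its first vertex. -/
lemma ConvexPosition.exists_fan {N : ℕ} {z : Fin N → ℂ} (hz : ConvexPosition z)
    (hN : 3 ≤ N) {a : ℂ} (ha : a ∈ convexHull ℝ (z '' Set.univ)) :
    ∃ k, ∃ hk : k + 1 < N, 1 ≤ k ∧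
      a ∈ convexHull ℝ (z '' {⟨0, by omega⟩, ⟨k, by omega⟩, ⟨k + 1, hk⟩}) := by
  have hside : ∀ k, ∀ hk : k + 1 < N, 0 ≤ orient (z ⟨k, by omega⟩) (z ⟨k + 1, hk⟩) a := by
    intro k hk
    refine orient_nonneg_of_mem_convexHull ha fun i _ => ?_
    rcases lt_or_ge i ⟨k, by omega⟩ with h | h
    · rw [← orient_rotate, ← orient_rotate, ← orient_rotate, orient_rotate]
      exact (hz _ _ _ h (by simp [Fin.lt_def])).le
    · rcases eq_or_lt_of_le h with h | h
      · rw [← h]; unfold orient; ring_nf; exact le_rfl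
      · rcases eq_or_lt_of_le (show (⟨k + 1, hk⟩ : Fin N) ≤ i by
          simp only [Fin.lt_def, Fin.le_def] at *; omega) with h' | h'
        · rw [← h']; unfold orient; ring_nf; exact le_rfl
        · exact (hz _ _ _ (by simp [Fin.lt_def]) h').le
  have hlast : orient (z ⟨0, by omega⟩) (z ⟨N - 1, by omega⟩) a ≤ 0 := by
    rw [← neg_nonneg, ← orient_swap]
    refine orient_nonneg_of_mem_convexHull ha fun i _ => ?_
    by_cases h0 : i.val = 0
    · have : i = ⟨0, by omega⟩ := Fin.ext h0
      rw [this]; unfold orient; ring_nf; exact le_rfl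
    by_cases h1 : i.val = N - 1
    · have : i = ⟨N - 1, by omega⟩ := Fin.ext h1
      rw [this]; unfold orient; ring_nf; exact le_rfl
    rw [orient_rotate, orient_rotate]
    have := i.isLt
    exact (hz ⟨0, by omega⟩ i ⟨N - 1, by omega⟩ (by simp only [Fin.lt_def]; omega)
      (by simp only [Fin.lt_def]; omega)).le
  have hex : ∃ m, ∃ hm : m + 2 < N, orient (z ⟨0, by omega⟩) (z ⟨m + 2, hm⟩) a ≤ 0 := by
    refine ⟨N - 3, by omega, ?_⟩
    convert hlast using 4
    omega
  classical
  -- Minimality puts `a` between the rays from vertex `0` to two consecutive vertices. For `m = 0`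
  -- the first ray is an edge, where `hside` replaces minimality.
  obtain ⟨hm, hmle⟩ := Nat.find_spec hex
  set m := Nat.find hex with hmdef
  refine ⟨m + 1, by omega, by omega, ?_⟩
  refine barycentric_mem_convexHull (u := z ⟨0, by omega⟩) (v := z ⟨m + 1, by omega⟩)
    (w := z ⟨m + 2, hm⟩) ⟨_, by simp, rfl⟩ ⟨_, by simp, rfl⟩ ⟨_, by simp, rfl⟩
    (hz _ _ _ (by simp [Fin.lt_def]) (by simp [Fin.lt_def])) (hside _ _) ?_ ?_
  · rw [orient_swap]; linarith
  · rcases Nat.eq_zero_or_pos m with h | h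
    · simp only [h]; exact hside 0 (by omega)
    · have := Nat.find_min hex (m := m - 1) (by omega)
      push Not at this
      have h2 := this (by omega)
      have e : m - 1 + 2 = m + 1 := by omega
      simp only [e] at h2
      exact h2.le

/-- Compression from two disjoint sets of vertices which separate each other's pairs, except that
`S` fails to separate the neighbours `j` and `j + 1`. This does no harm if `a` is in the hull of
vertices other than these two. -/
lemma ConvexPosition.diagCompression_of_pair {N : ℕ} {z : Fin N → ℂ} (hz : ConvexPosition z)
    (hN : 0 < N) {a b : ℂ} (ha : Deep z a) (hb : Deep z b) (S : Set (Fin N)) (j : Fin N)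
    (hS : ∀ i k, i < k → i ∈ S → k ∈ S →
      ∃ s ∉ S, ∃ t ∉ S, (i < s ∧ s < k) ∧ (t < i ∨ k < t))
    (hC : ∀ i k, i < k → i ∉ S → k ∉ S → (i = j ∧ k.val = j + 1) ∨
      ∃ s ∈ S, ∃ t ∈ S, (i < s ∧ s < k) ∧ (t < i ∨ k < t))
    (T : Set (Fin N)) (haT : a ∈ convexHull ℝ (z '' T))
    (hT : ∀ i ∈ T, i ≠ j ∧ i.val ≠ j + 1) :
    DiagCompression z a b := by
  refine diagCompression_of_disjoint z S Sᶜ (fun i hi hi' => hi' hi) ?_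
    (hb.mem_convexHull hz hN fun i k hik hi hk => hS i k hik (by simpa using hi)
      (by simpa using hk))
  by_contra h
  obtain ⟨f, c, hfa, hfS, i, k, hik, hi, hk, hfi, hfk, hno⟩ := ha.exists_cut hz hN h
  obtain ⟨t, htT, htc⟩ := exists_lt_of_mem_convexHull haT f hfa
  have htS : t ∉ S := fun h => (hfS t h).not_gt htc
  obtain ⟨htj, htj'⟩ := hT t htT
  have key : ∀ i k, i < k → i ∉ S → k ∉ S → f (z i) < c → f (z k) < c →
      i = j ∧ k.val = j + 1 := by
    intro i k hik hi hk hfi hfk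
    refine (hC i k hik hi hk).resolve_right ?_
    rintro ⟨s, hs, t, ht, ⟨h1, h2⟩, h3 | h3⟩
    · refine hz.not_separated h3 h1 h2 (-f) (-c) ?_ ?_ ?_ ?_ <;> simp <;>
        first | assumption | (apply hfS; assumption)
    -- By `key`, any two vertices in the cut-off half-plane are the exceptional pair; the triangle
    -- or other set `T` around `a` supplies a third vertex there, which is absurd.
    · exact hz.not_separated h1 h2 h3 f c hfi hfk (hfS s hs) (hfS t ht)
  obtain ⟨rfl, hkj⟩ := key i k hik hi hk hfi hfk
  rcases lt_or_gt_of_ne htj with h' | h'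
  · exact h'.ne (key t i h' htS hi htc hfi).1
  · exact htj' (key i t h' hi htS hfi htc).2

lemma ConvexPosition.diagCompression_odd {N : ℕ} {z : Fin N → ℂ} (hz : ConvexPosition z)
    (hN : 7 ≤ N) (hodd : N % 2 = 1) {a b : ℂ} (ha : Deep z a) (hb : Deep z b) :
    DiagCompression z a b := by
  obtain ⟨k, hk, hk1, hak⟩ := hz.exists_fan (by omega) (a := a)
    (convexHull_mono (Set.image_mono (Set.subset_univ _)) (ha ⟨0, by omega⟩))
  rcases le_or_gt 3 k with h3 | h3
  -- The triangle avoids vertices `1` and `2`. Take `S = {0, 3, 5, …, N - 2}`, with complement `{1,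
  -- 2, 4, 6, …, N - 1}`.
  · refine hz.diagCompression_of_pair (by omega) ha hb
      {i | i.val = 0 ∨ (3 ≤ i.val ∧ i.val % 2 = 1)} ⟨1, by omega⟩ ?_ ?_ _ hak ?_
    · intro i k hik hi hk
      have := k.isLt
      simp only [Set.mem_ofPred_eq, Fin.lt_def] at *
      by_cases h0 : i.val = 0
      · exact ⟨⟨1, by omega⟩, by dsimp only; omega, ⟨N - 1, by omega⟩, by dsimp only; omega,
          by dsimp only; omega, by dsimp only; omega⟩
      · exact ⟨⟨i + 1, by omega⟩, by dsimp only; omega, ⟨1, by omega⟩, by dsimp only; omega,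
          by dsimp only; omega, by dsimp only; omega⟩
    · intro i k hik hi hk
      have := k.isLt
      simp only [Set.mem_ofPred_eq, Fin.lt_def, Fin.ext_iff] at *
      by_cases hb : i.val = 1 ∧ k.val = 2
      · exact Or.inl hb
      · by_cases h1 : i.val = 1
        · exact Or.inr ⟨⟨3, by omega⟩, by dsimp only; omega, ⟨0, by omega⟩, by dsimp only; omega,
            by dsimp only; omega, by dsimp only; omega⟩
        · exact Or.inr ⟨⟨i + 1, by omega⟩, by dsimp only; omega, ⟨0, by omega⟩,
            by dsimp only; omega, by dsimp only; omega, by dsimp only; omega⟩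
    · intro i hi
      simp only [Set.mem_insert_iff, Set.mem_singleton_iff, Fin.ext_iff, ne_eq] at *
      omega
  -- The triangle lies in `{0, 1, 2, 3}`. Take `S = {1, 3, 6, 8, …, N - 1}`, with complement `{0, 2,
  -- 4, 5, 7, …, N - 2}`. Vertex `6` separates `5` from `0`, which requires `N ≥ 7`.
  · refine hz.diagCompression_of_pair (by omega) ha hb
      {i | (i.val ≤ 3 ∧ i.val % 2 = 1) ∨ (6 ≤ i.val ∧ i.val % 2 = 0)} ⟨4, by omega⟩ ?_ ?_ _ hak ?_
    · intro i k hik hi hk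
      have := k.isLt
      simp only [Set.mem_ofPred_eq, Fin.lt_def] at *
      exact ⟨⟨i + 1, by omega⟩, by dsimp only; omega, ⟨0, by omega⟩, by dsimp only; omega,
        by dsimp only; omega, by dsimp only; omega⟩
    · intro i k hik hi hk
      have := k.isLt
      simp only [Set.mem_ofPred_eq, Fin.lt_def, Fin.ext_iff] at *
      by_cases hb : i.val = 4 ∧ k.val = 5
      · exact Or.inl hb
      · by_cases h0 : i.val = 0
        · by_cases h2 : k.val = 2 ∨ k.val = 4 ∨ k.val = 5
          · exact Or.inr ⟨⟨1, by omega⟩, by dsimp only; omega, ⟨6, by omega⟩, by dsimp only; omega,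
              by dsimp only; omega, by dsimp only; omega⟩
          · exact Or.inr ⟨⟨1, by omega⟩, by dsimp only; omega, ⟨N - 1, by omega⟩,
              by dsimp only; omega, by dsimp only; omega, by dsimp only; omega⟩
        · by_cases h4 : i.val = 4
          · exact Or.inr ⟨⟨6, by omega⟩, by dsimp only; omega, ⟨1, by omega⟩,
              by dsimp only; omega, by dsimp only; omega, by dsimp only; omega⟩
          · exact Or.inr ⟨⟨i + 1, by omega⟩, by dsimp only; omega, ⟨1, by omega⟩,
              by dsimp only; omega, by dsimp only; omega, by dsimp only; omega⟩
    · intro i hi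
      simp only [Set.mem_insert_iff, Set.mem_singleton_iff, Fin.ext_iff, ne_eq] at *
      omega

/-! ### Small polygons, and deep points relative to chords -/

lemma Deep.false_one {z : Fin 1 → ℂ} {a : ℂ} (ha : Deep z a) : False := by
  have := ha 0
  rw [show ({0}ᶜ : Set (Fin 1)) = ∅ by ext i; simp [Subsingleton.elim i 0]] at this
  simp at this

/-- Deepness puts `a` on all three edges, so its three subtriangle areas are nonpositive, yet they
sum to the positive area of the triangle. -/
lemma Deep.false_three {z : Fin 3 → ℂ} (hz : ConvexPosition z) {a : ℂ} (ha : Deep z a) :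
    False := by
  have h : ∀ u v i, (∀ j, j ≠ i → orient u v (z j) = 0) → 0 ≤ -orient u v a := by
    intro u v i h
    rw [← orient_swap]
    refine orient_nonneg_of_mem_convexHull (ha i) fun j hj => ?_
    rw [orient_swap, h j hj, neg_zero]
  have h0 := h (z 1) (z 2) 0 (by
    intro j hj; fin_cases j <;> simp [orient] at *; ring)
  have h1 := h (z 2) (z 0) 1 (by
    intro j hj; fin_cases j <;> simp [orient] at *; ring)
  have h2 := h (z 0) (z 1) 2 (by
    intro j hj; fin_cases j <;> simp [orient] at *; ring)
  have := orient_sum_barycentric (z 0) (z 1) (z 2) a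
  have := hz 0 1 2 (by decide) (by decide)
  linarith

/-- A sum of nonnegative terms vanishes only termwise, so a point on a supporting line puts no
weight on vertices off that line. -/
lemma mem_convexHull_of_orient_eq_zero {ι : Type*} [Fintype ι] {z : ι → ℂ} {S : Set ι} {a u v : ℂ}
    (ha : a ∈ convexHull ℝ (z '' S)) (h : ∀ i ∈ S, 0 ≤ orient u v (z i)) (h0 : orient u v a = 0)
    {T : Set ι} (hT : ∀ i ∈ S, i ∉ T → 0 < orient u v (z i)) : a ∈ convexHull ℝ (z '' T) := by
  obtain ⟨p, hp, hpS, hp1, rfl⟩ := (mem_convexHull_image_iff z S a).1 ha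
  rw [orient_sum z p hp1, Finset.sum_eq_zero_iff_of_nonneg] at h0
  · refine (mem_convexHull_image_iff z T _).2 ⟨p, hp, fun i hi => ?_, hp1, rfl⟩
    by_cases hiS : i ∈ S
    · exact (mul_eq_zero.1 (h0 i (Finset.mem_univ i))).resolve_right (hT i hiS hi).ne'
    · exact hpS i hiS
  · intro i _
    by_cases hi : i ∈ S
    · exact mul_nonneg (hp i) (h i hi)
    · simp [hpS i hi]

lemma orient_self_left (u v : ℂ) : orient u v u = 0 := by unfold orient; ring

lemma orient_self_right (u v : ℂ) : orient u v v = 0 := by unfold orient; ring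

lemma ConvexPosition.orient_pos_of_outside {N : ℕ} {z : Fin N → ℂ} (hz : ConvexPosition z)
    {i k m : Fin N} (hik : i < k) (hm : m < i ∨ k < m) : 0 < orient (z i) (z k) (z m) := by
  rcases hm with hm | hm
  · rw [orient_rotate]; exact hz _ _ _ hm hik
  · exact hz _ _ _ hik hm

lemma ConvexPosition.orient_pos_of_between {N : ℕ} {z : Fin N → ℂ} (hz : ConvexPosition z)
    {i k m : Fin N} (hm : i < m ∧ m < k) : 0 < orient (z k) (z i) (z m) := by
  rw [← orient_rotate]; exact hz _ _ _ hm.1 hm.2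

/-- Only `l` can lie on the wrong side of the chord, and deepness allows it to be discarded. -/
lemma Deep.orient_nonneg_of_outside {N : ℕ} {z : Fin N → ℂ} (hz : ConvexPosition z) {a : ℂ}
    (ha : Deep z a) (i k l : Fin N) (hik : i < k) (h : ∀ m, m ≠ l → m ≤ i ∨ k ≤ m) :
    0 ≤ orient (z i) (z k) a := by
  refine orient_nonneg_of_mem_convexHull (ha l) fun m hm => ?_
  by_cases h1 : m = i
  · rw [h1, orient_self_left]
  by_cases h2 : m = k
  · rw [h2, orient_self_right]
  exact (hz.orient_pos_of_outside hik ((h m hm).imp (lt_of_le_of_ne · h1)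
    (lt_of_le_of_ne · (Ne.symm h2)))).le

lemma Deep.orient_nonneg_of_between {N : ℕ} {z : Fin N → ℂ} (hz : ConvexPosition z) {a : ℂ}
    (ha : Deep z a) (i k l : Fin N) (h : ∀ m, m ≠ l → i ≤ m ∧ m ≤ k) :
    0 ≤ orient (z k) (z i) a := by
  refine orient_nonneg_of_mem_convexHull (ha l) fun m hm => ?_
  by_cases h1 : m = i
  · rw [h1, orient_self_right]
  by_cases h2 : m = k
  · rw [h2, orient_self_left]
  exact (hz.orient_pos_of_between ⟨lt_of_le_of_ne (h m hm).1 (Ne.symm h1),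
    lt_of_le_of_ne (h m hm).2 h2⟩).le

lemma Deep.mem_chord_of_outside {N : ℕ} {z : Fin N → ℂ} (hz : ConvexPosition z) {a : ℂ}
    (ha : Deep z a) (i k l : Fin N) (hik : i < k) (h : ∀ m, m ≠ l → m ≤ i ∨ k ≤ m)
    (h0 : orient (z i) (z k) a = 0) : a ∈ convexHull ℝ (z '' {i, k}) := by
  have hpos : ∀ m ∈ ({l}ᶜ : Set (Fin N)), m ∉ ({i, k} : Set (Fin N)) →
      0 < orient (z i) (z k) (z m) := by
    intro m hm hm'
    simp only [Set.mem_insert_iff, Set.mem_singleton_iff, not_or] at hm'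
    exact hz.orient_pos_of_outside hik ((h m hm).imp (lt_of_le_of_ne · hm'.1)
      (lt_of_le_of_ne · (Ne.symm hm'.2)))
  refine mem_convexHull_of_orient_eq_zero (ha l) (fun m hm => ?_) h0 hpos
  by_cases hm' : m ∈ ({i, k} : Set (Fin N))
  · rcases hm' with rfl | rfl
    · rw [orient_self_left]
    · rw [orient_self_right]
  · exact (hpos m hm hm').le

lemma Deep.mem_chord_of_between {N : ℕ} {z : Fin N → ℂ} (hz : ConvexPosition z) {a : ℂ}
    (ha : Deep z a) (i k l : Fin N) (h : ∀ m, m ≠ l → i ≤ m ∧ m ≤ k)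
    (h0 : orient (z k) (z i) a = 0) : a ∈ convexHull ℝ (z '' {i, k}) := by
  have hpos : ∀ m ∈ ({l}ᶜ : Set (Fin N)), m ∉ ({i, k} : Set (Fin N)) →
      0 < orient (z k) (z i) (z m) := by
    intro m hm hm'
    simp only [Set.mem_insert_iff, Set.mem_singleton_iff, not_or] at hm'
    exact hz.orient_pos_of_between ⟨lt_of_le_of_ne (h m hm).1 (Ne.symm hm'.1),
      lt_of_le_of_ne (h m hm).2 hm'.2⟩
  refine mem_convexHull_of_orient_eq_zero (ha l) (fun m hm => ?_) h0 hpos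
  by_cases hm' : m ∈ ({i, k} : Set (Fin N))
  · rcases hm' with rfl | rfl
    · rw [orient_self_right]
    · rw [orient_self_left]
  · exact (hpos m hm hm').le

/-- A deep point is in the hull of the vertices off any chord that is not an edge. -/
lemma Deep.mem_convexHull_compl_pair {N : ℕ} {z : Fin N → ℂ} (hz : ConvexPosition z) {a : ℂ}
    (ha : Deep z a) (i k s t : Fin N) (h : (i < s ∧ s < k) ∧ (t < i ∨ k < t)) :
    a ∈ convexHull ℝ (z '' {i, k}ᶜ) := by
  refine ha.mem_convexHull hz i.pos fun j l hjl hj hl => ?_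
  have hik := h.1.1.trans h.1.2
  have hs : s ∈ ({i, k}ᶜ : Set (Fin N)) := by simp [h.1.1.ne', h.1.2.ne]
  have ht : t ∈ ({i, k}ᶜ : Set (Fin N)) := by
    rcases h.2 with h' | h'
    · simp [h'.ne, (h'.trans hik).ne]
    · simp [h'.ne', (hik.trans h').ne']
  simp only [Set.mem_compl_iff, not_not, Set.mem_insert_iff, Set.mem_singleton_iff] at hj hl
  rcases hj with rfl | rfl <;> rcases hl with rfl | rfl
  · exact absurd hjl (lt_irrefl _)
  · exact ⟨s, hs, t, ht, h⟩
  · exact absurd hjl hik.not_gt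
  · exact absurd hjl (lt_irrefl _)

/-! ### The pentagon -/

/-- The analytic core of the pentagon case, in coordinates: `α` and `β` weigh the vertices of a
quadrilateral and `d` lists the values of an affine function there. -/
lemma exists_quadrilateral_weights {α₁ α₂ α₄ β₁ β₃ β₄ : ℝ} (hα₁ : 0 < α₁) (hα₂ : 0 < α₂)
    (hα₄ : 0 < α₄) (hβ₁ : 0 < β₁) (hβ₃ : 0 < β₃) (hβ₄ : 0 < β₄)
    (d₁ d₂ d₃ d₄ : ℝ) (hd₂ : 0 ≤ d₂) (hd₃ : d₃ ≤ 0) :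
    ∃ p₁ p₂ p₃ p₄ s : ℝ, 0 ≤ s ∧ s ≤ 1 ∧ p₁ = α₁ + s * (β₁ - α₁) ∧ p₂ = (1 - s) * α₂ ∧
      p₃ = s * β₃ ∧ p₄ = α₄ + s * (β₄ - α₄) ∧ 0 < p₁ ∧ 0 ≤ p₂ ∧ 0 ≤ p₃ ∧ 0 < p₄ ∧ 0 < p₂ + p₃ ∧
      (β₁ - α₁) ^ 2 * (p₂ * p₃ * p₄) * d₁ + α₂ ^ 2 * (p₁ * p₃ * p₄) * d₂ +
        β₃ ^ 2 * (p₁ * p₂ * p₄) * d₃ + (β₄ - α₄) ^ 2 * (p₁ * p₂ * p₃) * d₄ = 0 := by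
  -- At `s = 0` only the `d₃` term survives and at `s = 1` only the `d₂` term, so the signs of `d₃`
  -- and `d₂` provide the root.
  set h : ℝ → ℝ := fun s =>
    (β₁ - α₁) ^ 2 * (((1 - s) * α₂) * (s * β₃) * (α₄ + s * (β₄ - α₄))) * d₁ +
    α₂ ^ 2 * ((α₁ + s * (β₁ - α₁)) * (s * β₃) * (α₄ + s * (β₄ - α₄))) * d₂ +
    β₃ ^ 2 * ((α₁ + s * (β₁ - α₁)) * ((1 - s) * α₂) * (α₄ + s * (β₄ - α₄))) * d₃ +
    (β₄ - α₄) ^ 2 * ((α₁ + s * (β₁ - α₁)) * ((1 - s) * α₂) * (s * β₃)) * d₄ with hh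
  have hcont : ContinuousOn h (Set.Icc 0 1) := by
    rw [hh]; fun_prop
  have h0 : h 0 ≤ 0 := by
    have : h 0 = β₃ ^ 2 * (α₁ * α₂ * α₄) * d₃ := by simp only [hh]; ring
    rw [this]; exact mul_nonpos_of_nonneg_of_nonpos (by positivity) hd₃
  have h1 : 0 ≤ h 1 := by
    have : h 1 = α₂ ^ 2 * (β₁ * β₃ * β₄) * d₂ := by simp only [hh]; ring
    rw [this]; positivity
  obtain ⟨s, ⟨hs0, hs1⟩, hs⟩ := intermediate_value_Icc zero_le_one hcont ⟨h0, h1⟩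
  have hpos : ∀ {x y : ℝ}, 0 < x → 0 < y → 0 < x + s * (y - x) := by
    intro x y hx hy
    have : 0 < (1 - s) * x + s * y := by
      rcases eq_or_lt_of_le hs0 with h | h
      · rw [← h]; simpa using hx
      · have := mul_pos h hy
        have := mul_nonneg (sub_nonneg.2 hs1) hx.le
        linarith
    linarith
  refine ⟨_, _, _, _, s, hs0, hs1, rfl, rfl, rfl, rfl, hpos hα₁ hβ₁,
    mul_nonneg (sub_nonneg.2 hs1) hα₂.le, mul_nonneg hs0 hβ₃.le, hpos hα₄ hβ₄, ?_, hs⟩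
  have := hpos hα₂ hβ₃
  linarith

lemma forall_fin_five {P : Fin 5 → Prop} : (∀ i, P i) ↔ P 0 ∧ P 1 ∧ P 2 ∧ P 3 ∧ P 4 := by
  refine ⟨fun h => ⟨h _, h _, h _, h _, h _⟩, ?_⟩
  rintro ⟨h0, h1, h2, h3, h4⟩ i
  fin_cases i <;> assumption

lemma exists_smul_of_orient_eq_zero {o x a : ℂ} (h : orient o x a = 0) (hne : a ≠ o) :
    ∃ μ : ℝ, x - o = μ • (a - o) := by
  by_cases hre : a.re = o.re
  · have him : a.im - o.im ≠ 0 := fun h' => hne (Complex.ext hre (sub_eq_zero.1 h'))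
    have hx : x.re - o.re = 0 := by
      simp only [orient, hre, sub_self, mul_zero, sub_zero] at h
      exact (mul_eq_zero.1 h).resolve_right him
    refine ⟨(x.im - o.im) / (a.im - o.im), Complex.ext ?_ ?_⟩
    · simp only [Complex.sub_re, Complex.smul_re, smul_eq_mul, hre, hx, sub_self, mul_zero]
    · simp only [Complex.sub_im, Complex.smul_im, smul_eq_mul, div_mul_cancel₀ _ him]
  · have hre' : a.re - o.re ≠ 0 := sub_ne_zero.2 hre
    refine ⟨(x.re - o.re) / (a.re - o.re), Complex.ext ?_ ?_⟩
    · simp only [Complex.sub_re, Complex.smul_re, smul_eq_mul, div_mul_cancel₀ _ hre']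
    · simp only [orient] at h
      simp only [Complex.sub_im, Complex.smul_im, smul_eq_mul]
      field_simp
      linarith

/-- Two weightings of a strictly convex quadrilateral `z 1, z 2, z 3, z 4` represent `b`, one
avoiding `z 3` and the other avoiding `z 2`. The pairs of weights
`p = (1 - s) • α + s • β`, `q j ∝ (β j - α j) ^ 2 * ∏ k ≠ j, p k` with `s ∈ [0, 1]` satisfy
`p j * q j ∝ (β j - α j) ^ 2`, and the point represented by `q` moves continuously from `z 3` to
`z 2`. At some moment it is collinear with `z 0` and `a`. -/
lemma ConvexPosition.diagCompression_five_of_pos {z : Fin 5 → ℂ} (hz : ConvexPosition z) {a b : ℂ}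
    (ha : Deep z a) (h24 : 0 < orient (z 2) (z 4) b)
    (h13 : 0 < orient (z 1) (z 3) b) (h41 : 0 < orient (z 4) (z 1) b) (hne : a ≠ z 0) :
    DiagCompression z b a := by
  have z014 := hz 0 1 4 (by decide) (by decide)
  have z024 := hz 0 2 4 (by decide) (by decide)
  have z123 := hz 1 2 3 (by decide) (by decide)
  have z124 := hz 1 2 4 (by decide) (by decide)
  have z134 := hz 1 3 4 (by decide) (by decide)
  have z234 := hz 2 3 4 (by decide) (by decide)
  have a24 := ha.orient_nonneg_of_outside hz 2 4 3 (by decide) (by decide)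
  have a41 := ha.orient_nonneg_of_between hz 1 4 0 (by decide)
  have a02 := ha.orient_nonneg_of_outside hz 0 2 1 (by decide) (by decide)
  have a30 := ha.orient_nonneg_of_between hz 0 3 4 (by decide)
  have h12 : 0 < orient (z 1) (z 2) b := by
    have e : orient (z 1) (z 2) b * orient (z 1) (z 3) (z 4) =
        orient (z 1) (z 2) (z 4) * orient (z 1) (z 3) b
          + orient (z 1) (z 2) (z 3) * orient (z 4) (z 1) b := by unfold orient; ring
    exact pos_of_mul_pos_left (e ▸ by positivity) z134.le
  have h34 : 0 < orient (z 3) (z 4) b := by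
    have e : orient (z 3) (z 4) b * orient (z 1) (z 2) (z 4) =
        orient (z 1) (z 3) (z 4) * orient (z 2) (z 4) b
          + orient (z 2) (z 3) (z 4) * orient (z 4) (z 1) b := by unfold orient; ring
    exact pos_of_mul_pos_left (e ▸ by positivity) z124.le
  have bα := orient_barycentric (z 1) (z 2) (z 4) b
  have sα := orient_sum_barycentric (z 1) (z 2) (z 4) b
  have bβ := orient_barycentric (z 1) (z 3) (z 4) b
  have sβ := orient_sum_barycentric (z 1) (z 3) (z 4) b
  have hα1 := div_pos h24 z124
  have hα2 := div_pos h41 z124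
  have hα4 := div_pos h12 z124
  have hβ1 := div_pos h34 z134
  have hβ3 := div_pos h41 z134
  have hβ4 := div_pos h13 z134
  have key : ∃ α₁ α₂ α₄ β₁ β₃ β₄ : ℝ, 0 < α₁ ∧ 0 < α₂ ∧ 0 < α₄ ∧ 0 < β₁ ∧ 0 < β₃ ∧ 0 < β₄ ∧
      α₁ + α₂ + α₄ = 1 ∧ β₁ + β₃ + β₄ = 1 ∧ α₁ • z 1 + α₂ • z 2 + α₄ • z 4 = b ∧
      β₁ • z 1 + β₃ • z 3 + β₄ • z 4 = b := by
    refine ⟨_, _, _, _, _, _, hα1, hα2, hα4, hβ1, hβ3, hβ4, ?_, ?_, ?_, ?_⟩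
    · rw [← add_div, ← add_div, sα, div_self z124.ne']
    · rw [← add_div, ← add_div, sβ, div_self z134.ne']
    · simp only [div_eq_inv_mul, mul_smul, ← smul_add]
      rw [← bα, smul_smul, inv_mul_cancel₀ z124.ne', one_smul]
    · simp only [div_eq_inv_mul, mul_smul, ← smul_add]
      rw [← bβ, smul_smul, inv_mul_cancel₀ z134.ne', one_smul]
  clear hα1 hα2 hα4 hβ1 hβ3 hβ4 bα sα bβ sβ
  obtain ⟨α₁, α₂, α₄, β₁, β₃, β₄, hα1, hα2, hα4, hβ1, hβ3, hβ4, sα, sβ, bα, bβ⟩ := key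
  obtain ⟨p₁, p₂, p₃, p₄, s, hs0, hs1, hp1, hp2, hp3, hp4, p1pos, p2pos, p3pos, p4pos, p23pos,
    hroot⟩ := exists_quadrilateral_weights hα1 hα2 hα4 hβ1 hβ3 hβ4 (orient (z 0) (z 1) a)
      (orient (z 0) (z 2) a) (orient (z 0) (z 3) a) (orient (z 0) (z 4) a) a02
      (by rw [orient_swap]; linarith)
  set g₁ := (β₁ - α₁) ^ 2 * (p₂ * p₃ * p₄) with hg1
  set g₂ := α₂ ^ 2 * (p₁ * p₃ * p₄) with hg2
  set g₃ := β₃ ^ 2 * (p₁ * p₂ * p₄) with hg3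
  set g₄ := (β₄ - α₄) ^ 2 * (p₁ * p₂ * p₃) with hg4
  have g1pos : 0 ≤ g₁ := by positivity
  have g2pos : 0 ≤ g₂ := by positivity
  have g3pos : 0 ≤ g₃ := by positivity
  have g4pos : 0 ≤ g₄ := by positivity
  have hG : 0 < g₁ + g₂ + g₃ + g₄ := by
    rcases lt_or_ge 0 p₂ with h | h
    · have : 0 < g₃ := by positivity
      linarith
    · have h3 : 0 < p₃ := by linarith
      have : 0 < g₂ := by positivity
      linarith
  set G := g₁ + g₂ + g₃ + g₄ with hGdef
  set t := p₁ * p₂ * p₃ * p₄ with ht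
  have t0 : 0 ≤ t := by positivity
  -- The difference of the two representations of `b` is the affine dependence to which the products
  -- of coordinates will be proportional.
  have hc : ((β₁ - α₁) • z 1 + (-α₂) • z 2 + β₃ • z 3 + (β₄ - α₄) • z 4 : ℂ) = 0 := by
    have := sub_eq_zero.2 (bβ.trans bα.symm)
    rw [← this]; module
  have hpb : (p₁ • z 1 + p₂ • z 2 + p₃ • z 3 + p₄ • z 4 : ℂ) = b := by
    calc (p₁ • z 1 + p₂ • z 2 + p₃ • z 3 + p₄ • z 4 : ℂ)
        = (1 - s) • (α₁ • z 1 + α₂ • z 2 + α₄ • z 4) + s • (β₁ • z 1 + β₃ • z 3 + β₄ • z 4) := by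
          rw [hp1, hp2, hp3, hp4]; module
      _ = b := by rw [bα, bβ]; module
  -- Collinearity alone is not enough: `1 ≤ μ` says that `a` lies between `z 0` and the point with
  -- weights `g / G`, so `a` is a convex combination of the two.
  have hray : ∃ μ : ℝ, 1 ≤ μ ∧ (g₁ • z 1 + g₂ • z 2 + g₃ • z 3 + g₄ • z 4 : ℂ)
      = G • (z 0 + μ • (a - z 0)) := by
    set g : ℂ := g₁ • z 1 + g₂ • z 2 + g₃ • z 3 + g₄ • z 4 with hg
    have hgre : g.re = g₁ * (z 1).re + g₂ * (z 2).re + g₃ * (z 3).re + g₄ * (z 4).re := by simp [hg]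
    have hgim : g.im = g₁ * (z 1).im + g₂ * (z 2).im + g₃ * (z 3).im + g₄ * (z 4).im := by simp [hg]
    have hor : orient (z 0) (G⁻¹ • g) a = 0 := by
      have : G * orient (z 0) (G⁻¹ • g) a = 0 := by
        rw [← hroot]
        simp only [orient, Complex.smul_re, Complex.smul_im, smul_eq_mul, hgre, hgim]
        field_simp
        rw [hGdef]; ring
      exact (mul_eq_zero.1 this).resolve_left hG.ne'
    obtain ⟨μ, hμ⟩ := exists_smul_of_orient_eq_zero hor hne
    have hgμ : g = G • (z 0 + μ • (a - z 0)) := by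
      rw [← hμ, add_sub_cancel, smul_smul, mul_inv_cancel₀ hG.ne', one_smul]
    refine ⟨μ, ?_, hgμ⟩
    have ere := congrArg Complex.re hgμ
    have eim := congrArg Complex.im hgμ
    simp only [hgre, hgim, Complex.smul_re, Complex.smul_im, Complex.add_re, Complex.add_im,
      Complex.sub_re, Complex.sub_im, smul_eq_mul] at ere eim
    have hval : ∀ u v : ℂ, g₁ * orient u v (z 1) + g₂ * orient u v (z 2) + g₃ * orient u v (z 3)
        + g₄ * orient u v (z 4)
        = G * (orient u v (z 0) + μ * (orient u v a - orient u v (z 0))) := by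
      intro u v
      unfold orient
      linear_combination (v.re - u.re) * eim - (v.im - u.im) * ere
        + ((v.re - u.re) * u.im - (v.im - u.im) * u.re) * hGdef
    have hcval : (β₁ - α₁) * orient (z 2) (z 4) (z 1) + β₃ * orient (z 2) (z 4) (z 3) = 0 := by
      have cre := congrArg Complex.re hc
      have cim := congrArg Complex.im hc
      simp only [Complex.smul_re, Complex.smul_im, Complex.add_re, Complex.add_im,
        smul_eq_mul, Complex.zero_re, Complex.zero_im] at cre cim
      unfold orient
      linear_combination ((z 4).re - (z 2).re) * cim - ((z 4).im - (z 2).im) * cre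
        + (((z 4).im - (z 2).im) * (z 2).re - ((z 4).re - (z 2).re) * (z 2).im) * (sβ - sα)
    have hbval : p₁ * orient (z 2) (z 4) (z 1) + p₃ * orient (z 2) (z 4) (z 3)
        = orient (z 2) (z 4) b := by
      have cre := congrArg Complex.re hpb
      have cim := congrArg Complex.im hpb
      have hp : p₁ + p₂ + p₃ + p₄ = 1 := by
        rw [hp1, hp2, hp3, hp4]; linear_combination (1 - s) * sα + s * sβ
      simp only [Complex.smul_re, Complex.smul_im, Complex.add_re, Complex.add_im,
        smul_eq_mul] at cre cim
      unfold orient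
      linear_combination ((z 4).re - (z 2).re) * cim - ((z 4).im - (z 2).im) * cre
        + (((z 4).im - (z 2).im) * (z 2).re - ((z 4).re - (z 2).re) * (z 2).im) * hp
    have hℓ := hval (z 2) (z 4)
    have hm := hval (z 4) (z 1)
    rw [orient_self_left, orient_self_right, mul_zero, mul_zero, add_zero, add_zero] at hℓ
    rw [orient_self_left, orient_self_right, mul_zero, mul_zero, add_zero, zero_add] at hm
    have e1 : orient (z 2) (z 4) (z 1) = orient (z 1) (z 2) (z 4) := orient_rotate _ _ _
    have e2 : orient (z 2) (z 4) (z 0) = orient (z 0) (z 2) (z 4) := orient_rotate _ _ _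
    have e3 : orient (z 4) (z 1) (z 2) = orient (z 1) (z 2) (z 4) := by
      rw [orient_rotate, orient_rotate]
    have e4 : orient (z 4) (z 1) (z 3) = orient (z 1) (z 3) (z 4) := by
      rw [orient_rotate, orient_rotate]
    have e5 : orient (z 4) (z 1) (z 0) = -orient (z 0) (z 1) (z 4) := by
      unfold orient; ring
    rw [e1] at hcval hbval
    rw [e1, e2] at hℓ
    rw [e3, e4, e5] at hm
    set L₁ := orient (z 1) (z 2) (z 4)
    set L₃ := orient (z 2) (z 4) (z 3)
    set L₀ := orient (z 0) (z 2) (z 4)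
    set m₀ := orient (z 0) (z 1) (z 4)
    -- The weighted point lies on or beyond the line through `z 2` and `z 4`, as seen from `z 0`.
    -- This is where the strict position of `b` relative to that line enters.
    have hle : g₁ * L₁ + g₃ * L₃ ≤ 0 := by
      have e : g₁ * L₁ + g₃ * L₃ = -(p₂ * p₄ * ((β₁ - α₁) * L₁) * (p₁ * β₃ - p₃ * (β₁ - α₁))) := by
        rw [hg1, hg3]; linear_combination p₁ * p₂ * p₄ * β₃ * hcval
      have hL₃ : L₃ < 0 := by
        have : L₃ = -orient (z 2) (z 3) (z 4) := by simp only [L₃]; unfold orient; ring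
        linarith
      have h1 : 0 < (β₁ - α₁) * L₁ := by linarith [mul_pos hβ3 (neg_pos.2 hL₃)]
      have h2 : 0 < p₁ * β₃ - p₃ * (β₁ - α₁) := by
        refine pos_of_mul_pos_left (b := L₁) ?_ z124.le
        have : (p₁ * β₃ - p₃ * (β₁ - α₁)) * L₁ = β₃ * orient (z 2) (z 4) b := by
          linear_combination β₃ * hbval - p₃ * hcval
        rw [this]; positivity
      rw [e]
      have := mul_nonneg (mul_nonneg (mul_nonneg p2pos p4pos.le) h1.le) h2.le
      linarith
    -- The line through `z 4` and `z 1` has `z 0` strictly on one side, and `a` and the weighted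
    -- point weakly on the other, which forces `μ > 0`. The line through `z 2` and `z 4` then gives
    -- `μ ≥ 1`.
    have hm0 : 0 ≤ -m₀ + μ * (orient (z 4) (z 1) a - -m₀) :=
      nonneg_of_mul_nonneg_right (hm ▸ by positivity) hG
    have hℓ0 : L₀ + μ * (orient (z 2) (z 4) a - L₀) ≤ 0 := by
      rw [hℓ] at hle
      exact nonpos_of_mul_nonpos_right hle hG
    have hμ0 : 0 < μ := by
      refine pos_of_mul_pos_left (b := orient (z 4) (z 1) a - -m₀) ?_ ?_ <;> linarith
    have := mul_nonneg hμ0.le a24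
    refine le_of_mul_le_mul_right (a := L₀) ?_ z024
    linarith
  obtain ⟨μ, hμ, hμg⟩ := hray
  have hGμ : 0 < G * μ := by positivity
  have hGμ' : √(G * μ) ^ 2 = G * μ := Real.sq_sqrt hGμ.le
  -- Vertex `0` carries weight for `a` only, so it adds nothing to the products. Elsewhere each `p j
  -- * g j` is `t` times the square of a dependence coefficient, whence the factor `√t / √(G * μ)`.
  refine diagCompression_of_weights z ![0, p₁, p₂, p₃, p₄]
    ![1 - 1 / μ, g₁ / (G * μ), g₂ / (G * μ), g₃ / (G * μ), g₄ / (G * μ)]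
    ![0, (√t / √(G * μ)) * (β₁ - α₁), (√t / √(G * μ)) * (-α₂), (√t / √(G * μ)) * β₃,
      (√t / √(G * μ)) * (β₄ - α₄)] ?_ ?_ ?_ ?_ ?_ ?_ ?_ ?_ ?_
  · rw [forall_fin_five]; simp [p1pos.le, p2pos, p3pos, p4pos.le]
  · have : 1 / μ ≤ 1 := by rw [div_le_one (by linarith)]; exact hμ
    rw [forall_fin_five]
    simp only [Fin.isValue, Matrix.cons_val]
    have hμ0 : 0 < μ := by linarith
    have hGμ0 : 0 ≤ G * μ := by positivity
    exact ⟨by linarith, div_nonneg g1pos hGμ0, div_nonneg g2pos hGμ0, div_nonneg g3pos hGμ0,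
      div_nonneg g4pos hGμ0⟩
  · simp [Fin.sum_univ_five, hp1, hp2, hp3, hp4]; linear_combination (1 - s) * sα + s * sβ
  · simp only [Fin.sum_univ_five, Fin.isValue, Matrix.cons_val]
    field_simp
    linarith
  · simpa [Fin.sum_univ_five] using hpb
  · simp only [Fin.sum_univ_five, Fin.isValue, Matrix.cons_val]
    have hμ0 : μ ≠ 0 := by positivity
    have : ((g₁ / (G * μ)) • z 1 + (g₂ / (G * μ)) • z 2 + (g₃ / (G * μ)) • z 3
        + (g₄ / (G * μ)) • z 4 : ℂ) = (1 / μ) • (z 0 + μ • (a - z 0)) := by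
      have := congrArg (fun x => (1 / (G * μ)) • x) hμg
      simp only [smul_add, smul_smul, one_div_mul_eq_div] at this ⊢
      convert this using 2 <;> congr 1 <;> field_simp
    calc _ = (1 - 1 / μ) • z 0 + ((g₁ / (G * μ)) • z 1 + (g₂ / (G * μ)) • z 2
          + (g₃ / (G * μ)) • z 3 + (g₄ / (G * μ)) • z 4) := by module
      _ = a := by
        rw [this, smul_add, smul_smul, one_div_mul_cancel hμ0]
        module
  · have hκ : (√t / √(G * μ)) ^ 2 = t / (G * μ) := by rw [div_pow, hGμ', Real.sq_sqrt t0]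
    generalize √t / √(G * μ) = κ at hκ
    rw [forall_fin_five]
    simp only [Fin.isValue, Matrix.cons_val]
    refine ⟨by simp, ?_, ?_, ?_, ?_⟩ <;> rw [mul_pow, hκ]
    · rw [hg1, ht]; ring
    · rw [hg2, ht]; ring
    · rw [hg3, ht]; ring
    · rw [hg4, ht]; ring
  · simp only [Fin.sum_univ_five, Fin.isValue, Matrix.cons_val]
    linear_combination (√t / √(G * μ)) * (sβ - sα)
  · simp only [Fin.sum_univ_five, Fin.isValue, Matrix.cons_val, mul_smul]
    rw [zero_smul, zero_add, ← smul_add, ← smul_add, ← smul_add, hc, smul_zero]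

/-- If `b` is on one of the diagonals `24`, `13`, `14`, its two ends serve `b` and the other three
vertices serve `a`. Otherwise the strict inequalities of the main case hold. -/
lemma ConvexPosition.diagCompression_five {z : Fin 5 → ℂ} (hz : ConvexPosition z) {a b : ℂ}
    (ha : Deep z a) (hb : Deep z b) : DiagCompression z a b := by
  have hchord : ∀ (i k s t : Fin 5), ((i < s ∧ s < k) ∧ (t < i ∨ k < t)) →
      b ∈ convexHull ℝ (z '' {i, k}) → DiagCompression z a b := fun i k s t h hb =>
    diagCompression_of_disjoint z {i, k}ᶜ {i, k} (fun i hi hi' => hi hi')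
      (ha.mem_convexHull_compl_pair hz i k s t h) hb
  rcases (hb.orient_nonneg_of_outside hz 2 4 3 (by decide) (by decide)).eq_or_lt with h24 | h24
  · exact hchord 2 4 3 0 (by decide)
      (hb.mem_chord_of_outside hz 2 4 3 (by decide) (by decide) h24.symm)
  rcases (hb.orient_nonneg_of_outside hz 1 3 2 (by decide) (by decide)).eq_or_lt with h13 | h13
  · exact hchord 1 3 2 0 (by decide)
      (hb.mem_chord_of_outside hz 1 3 2 (by decide) (by decide) h13.symm)
  rcases (hb.orient_nonneg_of_between hz 1 4 0 (by decide)).eq_or_lt with h41 | h41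
  · exact hchord 1 4 2 0 (by decide) (hb.mem_chord_of_between hz 1 4 0 (by decide) h41.symm)
  refine (hz.diagCompression_five_of_pos ha h24 h13 h41 ?_).symm
  rintro rfl
  have h := ha.orient_nonneg_of_between hz 1 4 0 (by decide)
  have h' := hz 0 1 4 (by decide) (by decide)
  have : orient (z 4) (z 1) (z 0) = -orient (z 0) (z 1) (z 4) := by unfold orient; ring
  linarith

lemma ConvexPosition.diagCompression {N : ℕ} {z : Fin N → ℂ} (hz : ConvexPosition z)
    (hN : 0 < N) {a b : ℂ} (ha : Deep z a) (hb : Deep z b) : DiagCompression z a b := by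
  rcases Nat.even_or_odd N with h | h
  · exact hz.diagCompression_even hN (Nat.even_iff.1 h) ha hb
  · rw [Nat.odd_iff] at h
    rcases le_or_gt 7 N with h7 | h7
    · exact hz.diagCompression_odd h7 h ha hb
    · obtain rfl | rfl | rfl : N = 1 ∨ N = 3 ∨ N = 5 := by omega
      · exact ha.false_one.elim
      · exact (ha.false_three hz).elim
      · exact hz.diagCompression_five ha hb

/-! ### Sorting extreme points into a convex polygon -/

/-- Orientation of two rays from `o` in the half-plane `0 < f`, read off their slopes `g / f`. -/
lemma orient_pos_of_slope_lt {o z w : ℂ} {f g : ℂ → ℝ} {c : ℝ} (hc : 0 < c)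
    (hfg : ∀ d e : ℂ, f d * g e - g d * f e = c * (d.re * e.im - d.im * e.re))
    (hz : 0 < f (z - o)) (hw : 0 < f (w - o)) (h : g (z - o) / f (z - o) < g (w - o) / f (w - o)) :
    0 < orient o z w := by
  rw [div_lt_div_iff₀ hz hw] at h
  have := hfg (z - o) (w - o)
  simp only [Complex.sub_re, Complex.sub_im] at this
  unfold orient
  exact pos_of_mul_pos_right (this ▸ by linarith) hc.le

/-- Points none of which is in the hull of the others are the vertices of a strictly convex
polygon, once they are sorted by slope around one of them. -/
lemma exists_perm_convexPosition {N : ℕ} (z : Fin N → ℂ) (hN : 0 < N)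
    (hz : ∀ j, z j ∉ convexHull ℝ (z '' {j}ᶜ)) :
    ∃ σ : Equiv.Perm (Fin N), ConvexPosition (z ∘ σ) := by
  set o : Fin N := ⟨0, hN⟩
  obtain ⟨F, c₀, hF1, hF2⟩ := not_mem_convexHull_separation (hz o)
  have hFpos : ∀ j, j ≠ o → 0 < F (z j - z o) := fun j hj => by
    rw [map_sub]; linarith [hF2 j hj]
  have hFval : ∀ d : ℂ, F d = d.re * F 1 + d.im * F Complex.I := by
    intro d
    conv_lhs => rw [show d = d.re • (1 : ℂ) + d.im • Complex.I by simp [Complex.re_add_im]]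
    rw [map_add, map_smul, map_smul, smul_eq_mul, smul_eq_mul]
  -- `G` is `F` precomposed with a quarter turn, so `(F, G)` are coordinates that scale oriented
  -- area by a nonnegative constant.
  set G : ℂ → ℝ := fun d => d.im * F 1 - d.re * F Complex.I with hG
  have hFG : ∀ d e : ℂ, F d * G e - G d * F e
      = (F 1 ^ 2 + F Complex.I ^ 2) * (d.re * e.im - d.im * e.re) := by
    intro d e
    simp only [hG, hFval d, hFval e]; ring
  by_cases hc : F 1 ^ 2 + F Complex.I ^ 2 = 0
  · have h1 : F 1 = 0 := by nlinarith [sq_nonneg (F 1), sq_nonneg (F Complex.I)]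
    have h2 : F Complex.I = 0 := by nlinarith [sq_nonneg (F 1), sq_nonneg (F Complex.I)]
    have hall : ∀ j, j = o := by
      intro j
      by_contra hj
      have := hFpos j hj
      rw [hFval, h1, h2] at this
      simp at this
    exact ⟨1, fun i j k hij _ => absurd ((hall i).trans (hall j).symm) hij.ne⟩
  have hcpos : 0 < F 1 ^ 2 + F Complex.I ^ 2 := lt_of_le_of_ne (by positivity) (Ne.symm hc)
  -- The value `⊥` makes the base point come first.
  let key : Fin N → WithBot ℝ := fun j =>
    if j = o then ⊥ else ((G (z j - z o) / F (z j - z o) : ℝ) : WithBot ℝ)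
  have hor0 : ∀ j k, j ≠ o → k ≠ o → j ≠ k → orient (z o) (z j) (z k) ≠ 0 := by
    have aux : ∀ j k, j ≠ o → k ≠ o → j ≠ k → F (z j - z o) ≤ F (z k - z o) →
        orient (z o) (z j) (z k) ≠ 0 := by
      intro j k hj hk hjk hle h0
      have hko : z k ≠ z o := by
        intro h; have := hFpos k hk; rw [h, sub_self, map_zero] at this; exact this.false
      have h0' : orient (z o) (z j) (z k) = 0 := h0
      obtain ⟨μ, hμ⟩ := exists_smul_of_orient_eq_zero h0' hko
      have hFj := hFpos j hj
      have hFk := hFpos k hk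
      have hμF : F (z j - z o) = μ * F (z k - z o) := by rw [hμ, map_smul, smul_eq_mul]
      have hμ0 : 0 ≤ μ := (pos_of_mul_pos_left (hμF ▸ hFj) hFk.le).le
      have hμ1 : μ ≤ 1 := by
        by_contra hcon
        have := mul_lt_mul_of_pos_right (not_le.1 hcon) hFk
        linarith
      refine hz j ?_
      have : z j = (1 - μ) • z o + μ • z k := by
        rw [← sub_add_cancel (z j) (z o), hμ]; module
      rw [this]
      exact convex_convexHull ℝ _ (subset_convexHull ℝ (z '' {j}ᶜ) ⟨o, Ne.symm hj, rfl⟩)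
        (subset_convexHull ℝ (z '' {j}ᶜ) ⟨k, Ne.symm hjk, rfl⟩) (by linarith) hμ0 (by ring)
    intro j k hj hk hjk
    rcases le_total (F (z j - z o)) (F (z k - z o)) with h | h
    · exact aux j k hj hk hjk h
    · have := aux k j hk hj hjk.symm h
      rw [orient_rotate, ← orient_rotate, orient_swap, neg_ne_zero] at this
      rwa [← orient_rotate, ← orient_rotate]
  have hkey : ∀ j k, j ≠ o → k ≠ o → j ≠ k → key j ≤ key k → 0 < orient (z o) (z j) (z k) := by
    intro j k hj hk hjk hle
    simp only [key, hj, hk, if_false, WithBot.coe_le_coe] at hle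
    rcases hle.lt_or_eq with h | h
    · exact orient_pos_of_slope_lt hcpos hFG (hFpos j hj) (hFpos k hk) h
    · exfalso
      refine hor0 j k hj hk hjk ?_
      rw [div_eq_div_iff (hFpos j hj).ne' (hFpos k hk).ne'] at h
      have := hFG (z j - z o) (z k - z o)
      simp only [Complex.sub_re, Complex.sub_im] at this
      unfold orient
      exact (mul_eq_zero.1 (this.symm.trans (by linarith))).resolve_left hc
  refine ⟨Tuple.sort key, fun i j k hij hjk => ?_⟩
  have hmono := Tuple.monotone_sort key
  have hinj := (Tuple.sort key).injective
  simp only [Function.comp_apply]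
  have hij' : key (Tuple.sort key i) ≤ key (Tuple.sort key j) := hmono hij.le
  have hjk' : key (Tuple.sort key j) ≤ key (Tuple.sort key k) := hmono hjk.le
  have hne1 := hinj.ne hij.ne
  have hne2 := hinj.ne hjk.ne
  have hne3 := hinj.ne (hij.trans hjk).ne
  generalize Tuple.sort key i = i at *
  generalize Tuple.sort key j = j at *
  generalize Tuple.sort key k = k at *
  have hbot : ∀ i j, i ≠ j → key i ≤ key j → j ≠ o := by
    rintro i j hij hle rfl
    simp only [key, if_true, hij, if_false, le_bot_iff] at hle
    exact WithBot.coe_ne_bot hle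
  have hj := hbot i j hne1 hij'
  have hk := hbot j k hne2 hjk'
  by_cases hi : i = o
  · rw [hi]; exact hkey j k hj hk hne2 hjk'
  have h1 := hkey i j hi hj hne1 hij'
  have h2 := hkey j k hj hk hne2 hjk'
  have h3 := hkey i k hi hk hne3 (hij'.trans hjk')
  -- Otherwise `z j` would lie in the triangle formed by `z o`, `z i` and `z k`.
  by_contra hcon
  refine hz j (barycentric_mem_convexHull (u := z o) (v := z i) (w := z k)
    ⟨o, Ne.symm hj, rfl⟩ ⟨i, hne1, rfl⟩ ⟨k, hne2.symm, rfl⟩ h3 ?_ ?_ h1.le)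
  · have : orient (z i) (z k) (z j) = -orient (z i) (z j) (z k) := by unfold orient; ring
    linarith
  · rw [orient_rotate, orient_rotate] at *
    rw [← orient_rotate]
    exact (by simpa [orient_rotate] using h2.le)

lemma DiagCompression.of_perm {N : ℕ} {z : Fin N → ℂ} {σ : Equiv.Perm (Fin N)} {a b : ℂ}
    (h : DiagCompression (z ∘ σ) a b) : DiagCompression z a b := by
  obtain ⟨x, y, h1, h2, h3, h4, h5, h6⟩ := h
  refine ⟨x ∘ σ.symm, y ∘ σ.symm, ?_, ?_, ?_, ?_, ?_, ?_⟩
  · rw [← h1, ← Equiv.sum_comp σ]; simp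
  · rw [← h2, ← Equiv.sum_comp σ]; simp
  · rw [← h3, ← Equiv.sum_comp σ]; simp
  · rw [← h4, ← Equiv.sum_comp σ]; simp
  · rw [← h5, ← Equiv.sum_comp σ]; simp
  · rw [← h6, ← Equiv.sum_comp σ]; simp

theorem diagCompression_of_deep {N : ℕ} {z : Fin N → ℂ} (hN : 0 < N)
    (hz : ∀ j, z j ∉ convexHull ℝ (z '' {j}ᶜ)) {a b : ℂ} (ha : Deep z a) (hb : Deep z b) :
    DiagCompression z a b := by
  obtain ⟨σ, hσ⟩ := exists_perm_convexPosition z hN hz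
  have hdeep : ∀ {c}, Deep z c → Deep (z ∘ σ) c := by
    intro c hc j
    have : (z ∘ σ) '' {j}ᶜ = z '' {σ j}ᶜ := by
      rw [Set.image_comp, Set.image_compl_eq σ.bijective, Set.image_singleton]
    rw [this]; exact hc (σ j)
  exact (hσ.diagCompression hN (hdeep ha) (hdeep hb)).of_perm

/-! ### Diagonalization and numerical ranges -/

open Matrix

lemma star_dotProduct_self_eq {N : ℕ} (u : Fin N → ℂ) :
    star u ⬝ᵥ u = ((∑ i, Complex.normSq (u i) : ℝ) : ℂ) := by
  simp only [dotProduct, Pi.star_apply, Complex.ofReal_sum]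
  exact Finset.sum_congr rfl fun i _ => (Complex.normSq_eq_conj_mul_self).symm

lemma sum_normSq_pos {N : ℕ} {u : Fin N → ℂ} (hu : u ≠ 0) :
    0 < ∑ i, Complex.normSq (u i) := by
  obtain ⟨i, hi⟩ := Function.ne_iff.1 hu
  exact Finset.sum_pos' (fun i _ => Complex.normSq_nonneg _)
    ⟨i, Finset.mem_univ i, Complex.normSq_pos.2 hi⟩

/-- An eigenvector of a normal matrix is an eigenvector of its adjoint. -/
lemma conjTranspose_mulVec_of_mulVec_eq {N : ℕ} {M : Matrix (Fin N) (Fin N) ℂ}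
    (hM : IsStarNormal M) {c : ℂ} {e : Fin N → ℂ} (h : M *ᵥ e = c • e) :
    Mᴴ *ᵥ e = star c • e := by
  have hcomm : M * Mᴴ = Mᴴ * M := hM.star_comm_self.eq.symm
  set A := M - c • (1 : Matrix (Fin N) (Fin N) ℂ) with hA
  have hA0 : A *ᵥ e = 0 := by rw [hA, sub_mulVec, smul_mulVec, one_mulVec, h, sub_self]
  have hAH : Aᴴ = Mᴴ - star c • (1 : Matrix (Fin N) (Fin N) ℂ) := by
    rw [hA, conjTranspose_sub, conjTranspose_smul, conjTranspose_one]
  have hAA : A * Aᴴ = Aᴴ * A := by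
    rw [hAH, hA]
    simp only [sub_mul, mul_sub, hcomm, smul_mul_assoc, mul_smul_comm, one_mul, mul_one,
      smul_sub, smul_smul, mul_comm c]
    abel
  -- Normality of `A` gives `‖Aᴴ e‖ = ‖A e‖`.
  have : star (Aᴴ *ᵥ e) ⬝ᵥ (Aᴴ *ᵥ e) = 0 := by
    rw [star_mulVec, conjTranspose_conjTranspose, ← dotProduct_mulVec, mulVec_mulVec, hAA,
      ← mulVec_mulVec, hA0, mulVec_zero, dotProduct_zero]
  rw [star_dotProduct_self_eq, Complex.ofReal_eq_zero] at this
  have h0 : Aᴴ *ᵥ e = 0 := by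
    by_contra hne
    exact (sum_normSq_pos hne).ne' this
  rw [hAH, sub_mulVec, smul_mulVec, one_mulVec, sub_eq_zero] at h0
  exact h0

/-- Unitary diagonalization of a normal matrix with simple spectrum. -/
lemma exists_unitary_diagonalization {N : ℕ} {M : Matrix (Fin N) (Fin N) ℂ} (hM : IsStarNormal M)
    {z : Fin N → ℂ} (hz : M.charpoly.roots = Finset.univ.val.map z)
    (hdistinct : Function.Injective z) :
    ∃ V ∈ unitaryGroup (Fin N) ℂ, M = V * diagonal z * Vᴴ := by
  have hev : ∀ i, ∃ e : Fin N → ℂ, star e ⬝ᵥ e = 1 ∧ M *ᵥ e = z i • e := by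
    intro i
    have hroot : M.charpoly.IsRoot (z i) := by
      apply Polynomial.isRoot_of_mem_roots
      rw [hz]
      exact Multiset.mem_map_of_mem z (Finset.mem_univ_val i)
    rw [Polynomial.IsRoot, eval_charpoly] at hroot
    obtain ⟨e, he, hMe⟩ := exists_mulVec_eq_zero_iff.2 hroot
    have hMe' : M *ᵥ e = z i • e := by
      rw [sub_mulVec, sub_eq_zero, scalar_apply, ← smul_one_eq_diagonal, smul_mulVec,
        one_mulVec] at hMe
      exact hMe.symm
    have hpos := sum_normSq_pos he
    set r := ∑ i, Complex.normSq (e i)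
    refine ⟨(((√r)⁻¹ : ℝ) : ℂ) • e, ?_, ?_⟩
    · rw [star_smul, smul_dotProduct, dotProduct_smul, star_dotProduct_self_eq, smul_eq_mul,
        smul_eq_mul, Complex.star_def, Complex.conj_ofReal, ← Complex.ofReal_mul,
        ← Complex.ofReal_mul, ← mul_assoc, ← mul_inv, Real.mul_self_sqrt hpos.le,
        inv_mul_cancel₀ hpos.ne', Complex.ofReal_one]
    · rw [mulVec_smul, hMe', smul_comm]
  choose e he1 heM using hev
  set V : Matrix (Fin N) (Fin N) ℂ := of fun i j => e j i with hV
  have hVV : Vᴴ * V = 1 := by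
    ext i j
    have hij : (Vᴴ * V) i j = star (e i) ⬝ᵥ e j := by
      simp [mul_apply, dotProduct, hV]
    rw [hij]
    by_cases h : i = j
    · subst h; rw [he1, one_apply_eq]
    · rw [one_apply_ne h]
      have h1 : star (e i) ⬝ᵥ (M *ᵥ e j) = z j * (star (e i) ⬝ᵥ e j) := by
        rw [heM, dotProduct_smul, smul_eq_mul]
      have h2 : star (e i) ⬝ᵥ (M *ᵥ e j) = z i * (star (e i) ⬝ᵥ e j) := by
        rw [dotProduct_mulVec, ← conjTranspose_conjTranspose M, ← star_mulVec,
          conjTranspose_mulVec_of_mulVec_eq hM (heM i), star_smul, star_star, smul_dotProduct,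
          smul_eq_mul]
      have h3 : (z j - z i) * (star (e i) ⬝ᵥ e j) = 0 := by
        rw [sub_mul, ← h1, h2, sub_self]
      exact (mul_eq_zero.1 h3).resolve_left
        (sub_ne_zero.2 fun h' => h (hdistinct h'.symm))
  have hVmem : V ∈ unitaryGroup (Fin N) ℂ := mem_unitaryGroup_iff'.2 hVV
  have hVV' : V * Vᴴ = 1 := mem_unitaryGroup_iff.1 hVmem
  refine ⟨V, hVmem, ?_⟩
  have hMV : M * V = V * diagonal z := by
    ext i j
    have := congrFun (heM j) i
    rw [mul_diagonal]
    simpa [mul_apply, mulVec, dotProduct, hV, mul_comm] using this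
  rw [← hMV, mul_assoc, hVV', mul_one]

section Diagonalized

variable {N : ℕ} {M V : Matrix (Fin N) (Fin N) ℂ} {z : Fin N → ℂ}

lemma star_dotProduct_mulVec_eq (hMV : M = V * diagonal z * Vᴴ) (u : Fin N → ℂ) :
    star u ⬝ᵥ (M *ᵥ u) = ∑ i, Complex.normSq ((Vᴴ *ᵥ u) i) • z i := by
  have : star u ⬝ᵥ (M *ᵥ u) = star (Vᴴ *ᵥ u) ⬝ᵥ (diagonal z *ᵥ (Vᴴ *ᵥ u)) := by
    rw [star_mulVec, conjTranspose_conjTranspose, ← dotProduct_mulVec, mulVec_mulVec,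
      mulVec_mulVec, hMV, mul_assoc]
  rw [this]
  simp only [dotProduct, mulVec_diagonal, Pi.star_apply]
  refine Finset.sum_congr rfl fun i _ => ?_
  rw [Complex.real_smul, Complex.normSq_eq_conj_mul_self, Complex.star_def]
  ring

lemma sum_normSq_conjTranspose_mulVec (hV : V ∈ unitaryGroup (Fin N) ℂ) (u : Fin N → ℂ) :
    ∑ i, Complex.normSq ((Vᴴ *ᵥ u) i) = ∑ i, Complex.normSq (u i) := by
  have hVV' : V * Vᴴ = 1 := mem_unitaryGroup_iff.1 hV
  apply Complex.ofReal_injective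
  rw [← star_dotProduct_self_eq, ← star_dotProduct_self_eq, star_mulVec,
    conjTranspose_conjTranspose, ← dotProduct_mulVec, mulVec_mulVec, hVV', one_mulVec]

lemma numericalRange_eq_convexHull (hV : V ∈ unitaryGroup (Fin N) ℂ)
    (hMV : M = V * diagonal z * Vᴴ) :
    numericalRange M = convexHull ℝ (z '' Set.univ) := by
  have hVV : Vᴴ * V = 1 := mem_unitaryGroup_iff'.1 hV
  ext c
  rw [mem_convexHull_image_iff]
  constructor
  · rintro ⟨u, hu, rfl⟩
    refine ⟨fun i => Complex.normSq ((Vᴴ *ᵥ u.ofLp) i), fun i => Complex.normSq_nonneg _,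
      fun i hi => absurd (Set.mem_univ i) hi, ?_, (star_dotProduct_mulVec_eq hMV _).symm⟩
    rw [sum_normSq_conjTranspose_mulVec hV]
    have := EuclideanSpace.norm_sq_eq u
    rw [hu, one_pow] at this
    simp only [Complex.normSq_eq_norm_sq]
    exact this.symm
  · rintro ⟨p, hp, -, hp1, rfl⟩
    set y : Fin N → ℂ := fun i => ((√(p i) : ℝ) : ℂ) with hy
    have hyn : ∀ i, Complex.normSq (y i) = p i := fun i => by
      rw [hy, Complex.normSq_ofReal, Real.mul_self_sqrt (hp i)]
    have hVy : Vᴴ *ᵥ (V *ᵥ y) = y := by rw [mulVec_mulVec, hVV, one_mulVec]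
    refine ⟨WithLp.toLp 2 (V *ᵥ y), ?_, ?_⟩
    · have h1 := EuclideanSpace.norm_sq_eq (WithLp.toLp 2 (V *ᵥ y))
      have h2 := sum_normSq_conjTranspose_mulVec hV (V *ᵥ y)
      rw [hVy] at h2
      simp only [hyn, hp1] at h2
      simp only [← Complex.normSq_eq_norm_sq, ← h2] at h1
      exact (pow_eq_one_iff_of_nonneg (norm_nonneg _) two_ne_zero).1 h1
    · rw [star_dotProduct_mulVec_eq hMV]
      simp only [hVy, hyn]

/-- A point of the rank-2 numerical range survives the removal of any eigenvalue. -/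
lemma deep_of_mem_rankNumericalRange (hV : V ∈ unitaryGroup (Fin N) ℂ)
    (hMV : M = V * diagonal z * Vᴴ) {a : ℂ} (ha : a ∈ rankNumericalRange 2 M) : Deep z a := by
  obtain ⟨P, hPH, hPP, hPr, hPM⟩ := ha
  intro j
  let φ : (Fin N → ℂ) →ₗ[ℂ] ℂ := (LinearMap.proj j).comp Vᴴ.mulVecLin
  have hfin : Module.finrank ℂ ℂ < Module.finrank ℂ (LinearMap.range P.mulVecLin) := by
    rw [Module.finrank_self, show Module.finrank ℂ (LinearMap.range P.mulVecLin) = 2 from hPr]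
    exact one_lt_two
  -- One linear condition, the vanishing of the `j`-th eigencoordinate, has a nonzero solution in
  -- the two-dimensional range of `P`.
  obtain ⟨⟨u, w, rfl⟩, hker, hne⟩ := (Submodule.ne_bot_iff _).1
    (LinearMap.ker_ne_bot_of_finrank_lt (f := φ.domRestrict (LinearMap.range P.mulVecLin)) hfin)
  simp only [mulVecLin_apply] at hker hne
  have hker' : (Vᴴ *ᵥ (P *ᵥ w)) j = 0 := hker
  have hne' : P *ᵥ w ≠ 0 := fun h => hne (Subtype.ext h)
  set u := P *ᵥ w with hu
  have hPu : P *ᵥ u = u := by rw [hu, mulVec_mulVec, hPP]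
  have hS := sum_normSq_pos hne'
  have hSV := sum_normSq_conjTranspose_mulVec hV u
  have hMu : star u ⬝ᵥ (M *ᵥ u) = a * (star u ⬝ᵥ u) := by
    calc star u ⬝ᵥ (M *ᵥ u) = star (P *ᵥ u) ⬝ᵥ (M *ᵥ (P *ᵥ u)) := by rw [hPu]
      _ = star u ⬝ᵥ ((P * M * P) *ᵥ u) := by
        rw [star_mulVec, hPH.eq, ← dotProduct_mulVec, mulVec_mulVec, mulVec_mulVec, mul_assoc]
      _ = a * (star u ⬝ᵥ u) := by
        rw [hPM, smul_mulVec, hPu, dotProduct_smul, smul_eq_mul]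
  rw [star_dotProduct_mulVec_eq hMV, star_dotProduct_self_eq] at hMu
  set S := ∑ i, Complex.normSq (u i)
  rw [mem_convexHull_image_iff]
  refine ⟨fun i => Complex.normSq ((Vᴴ *ᵥ u) i) / S,
    fun i => div_nonneg (Complex.normSq_nonneg _) hS.le, fun i hi => ?_, ?_, ?_⟩
  · have : i = j := by simpa using hi
    simp [this, hker']
  · rw [← Finset.sum_div, hSV, div_self hS.ne']
  · simp only [div_eq_inv_mul, mul_smul]
    rw [← Finset.smul_sum, hMu, Complex.real_smul, Complex.ofReal_inv]
    field_simp [Complex.ofReal_ne_zero.2 hS.ne']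

lemma two_le_of_mem_rankNumericalRange {a : ℂ} (ha : a ∈ rankNumericalRange 2 M) : 2 ≤ N := by
  obtain ⟨P, -, -, hPr, -⟩ := ha
  simpa [hPr] using P.rank_le_card_width

lemma isCompression_of_diagCompression (hV : V ∈ unitaryGroup (Fin N) ℂ)
    (hMV : M = V * diagonal z * Vᴴ) (hN : 2 ≤ N) {a b : ℂ} (h : DiagCompression z a b) :
    IsCompression !![a, 0; 0, b] M := by
  obtain ⟨x, y, hx1, hxa, hy1, hyb, hxy, hxyz⟩ := h
  have hVV : Vᴴ * V = 1 := mem_unitaryGroup_iff'.1 hV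
  set X : EuclideanSpace ℂ (Fin N) := WithLp.toLp 2 fun i => (x i : ℂ) with hX
  set Y : EuclideanSpace ℂ (Fin N) := WithLp.toLp 2 fun i => (y i : ℂ) with hY
  have hXn : ‖X‖ = 1 := by
    have := EuclideanSpace.norm_sq_eq X
    simp only [hX, Complex.norm_real, Real.norm_eq_abs, sq_abs, hx1] at this
    exact (pow_eq_one_iff_of_nonneg (norm_nonneg _) two_ne_zero).1 this
  have hYn : ‖Y‖ = 1 := by
    have := EuclideanSpace.norm_sq_eq Y
    simp only [hY, Complex.norm_real, Real.norm_eq_abs, sq_abs, hy1] at this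
    exact (pow_eq_one_iff_of_nonneg (norm_nonneg _) two_ne_zero).1 this
  have hXY : inner ℂ X Y = 0 := by
    have : inner ℂ X Y = ((∑ i, x i * y i : ℝ) : ℂ) := by
      simp [PiLp.inner_apply, hX, hY, mul_comm]
    rw [this, hxy, Complex.ofReal_zero]
  -- Only indices `0` and `1` matter; the remaining values are placeholders that the basis extension
  -- ignores.
  let v : Fin N → EuclideanSpace ℂ (Fin N) := fun i => if i.val = 0 then X else Y
  have hv : Orthonormal ℂ (Set.domRestrict {i : Fin N | i.val < 2} v) := by
    refine ⟨fun i => ?_, ?_⟩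
    · simp only [Set.domRestrict_apply, v]; split_ifs <;> assumption
    · rintro ⟨i, hi⟩ ⟨j, hj⟩ hij
      have hij' : i.val ≠ j.val := fun h => hij (Subtype.ext (Fin.ext h))
      change i.val < 2 at hi
      change j.val < 2 at hj
      simp only [Set.domRestrict_apply, v]
      split_ifs with h1 h2 h2
      · omega
      · exact hXY
      · rw [← inner_conj_symm, hXY, map_zero]
      · omega
  obtain ⟨β, hβ⟩ := hv.exists_orthonormalBasis_extension_of_card_eq (by simp)
  set B : Matrix (Fin N) (Fin N) ℂ := of fun i k => star (β i k) with hB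
  have hBB : B * Bᴴ = 1 := by
    ext i j
    have : (B * Bᴴ) i j = inner ℂ (β i) (β j) := by
      simp [mul_apply, hB, PiLp.inner_apply, mul_comm]
    rw [this, orthonormal_iff_ite.1 β.orthonormal, one_apply]
  have hBmem : B ∈ unitaryGroup (Fin N) ℂ := mem_unitaryGroup_iff.2 hBB
  refine ⟨hN, B * star V, mul_mem hBmem (Unitary.star_mem hV), ?_⟩
  have hU : B * star V * M * (B * star V)ᴴ = B * diagonal z * Bᴴ := by
    rw [star_eq_conjTranspose, conjTranspose_mul, conjTranspose_conjTranspose, hMV]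
    calc B * Vᴴ * (V * diagonal z * Vᴴ) * (V * Bᴴ)
        = B * (Vᴴ * V) * diagonal z * (Vᴴ * V) * Bᴴ := by simp only [mul_assoc]
      _ = B * diagonal z * Bᴴ := by rw [hVV, mul_one, mul_one]
  have hentry : ∀ i j, (B * diagonal z * Bᴴ) i j = ∑ k, star (β i k) * z k * β j k := by
    intro i j
    simp [mul_apply, hB, diagonal_apply]
  rw [hU]
  have h0 : β (Fin.castLE hN 0) = X := by
    rw [hβ _ (by simp)]; simp [v]
  have h1 : β (Fin.castLE hN 1) = Y := by
    rw [hβ _ (by simp)]; simp [v]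
  have hxyz' : ∑ k, (x k : ℂ) * z k * (y k : ℂ) = 0 := by
    rw [← hxyz]
    refine Finset.sum_congr rfl fun k _ => ?_
    rw [Complex.real_smul, Complex.ofReal_mul]; ring
  ext i j
  rw [submatrix_apply, hentry]
  fin_cases i <;> fin_cases j <;>
    simp only [Fin.zero_eta, Fin.mk_one, h0, h1, hX, hY, Complex.star_def, Complex.conj_ofReal,
      of_apply, cons_val', cons_val_zero, cons_val_one, cons_val_fin_one]
  · rw [← hxa]
    refine Finset.sum_congr rfl fun k _ => ?_
    rw [Complex.real_smul, Complex.ofReal_pow]; ring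
  · exact hxyz'.symm
  · rw [← hxyz']
    exact Finset.sum_congr rfl fun k _ => by ring
  · rw [← hyb]
    refine Finset.sum_congr rfl fun k _ => ?_
    rw [Complex.real_smul, Complex.ofReal_pow]; ring

/-- Removing an extreme point from a convex set leaves it convex, and by distinctness the other
eigenvalues all remain. -/
lemma not_mem_convexHull_of_mem_extremePoints (hV : V ∈ unitaryGroup (Fin N) ℂ)
    (hMV : M = V * diagonal z * Vᴴ) (hdistinct : Function.Injective z) {j : Fin N}
    (hj : z j ∈ (numericalRange M).extremePoints ℝ) : z j ∉ convexHull ℝ (z '' {j}ᶜ) := by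
  rw [numericalRange_eq_convexHull hV hMV,
    (convex_convexHull ℝ _).mem_extremePoints_iff_convex_sdiff] at hj
  intro hmem
  refine (convexHull_min ?_ hj.2 hmem).2 rfl
  rintro _ ⟨i, hi, rfl⟩
  exact ⟨subset_convexHull _ _ ⟨i, Set.mem_univ i, rfl⟩, fun h => hi (hdistinct h)⟩

/-- The eigenvalues lie on the unit circle, the disc is strictly convex, and extremality passes to
subsets containing the point. -/
lemma mem_extremePoints_of_unitary (hV : V ∈ unitaryGroup (Fin N) ℂ)
    (hMV : M = V * diagonal z * Vᴴ) (hM : M ∈ unitaryGroup (Fin N) ℂ) (j : Fin N) :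
    z j ∈ (numericalRange M).extremePoints ℝ := by
  have hVV : Vᴴ * V = 1 := mem_unitaryGroup_iff'.1 hV
  have hVV' : V * Vᴴ = 1 := mem_unitaryGroup_iff.1 hV
  have hMM : Mᴴ * M = 1 := mem_unitaryGroup_iff'.1 hM
  have hD : Vᴴ * M * V = diagonal z := by
    rw [hMV]
    calc Vᴴ * (V * diagonal z * Vᴴ) * V = (Vᴴ * V) * diagonal z * (Vᴴ * V) := by
          simp only [mul_assoc]
      _ = diagonal z := by rw [hVV, mul_one, one_mul]
  have hDD : (diagonal z)ᴴ * diagonal z = 1 := by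
    rw [← hD, conjTranspose_mul, conjTranspose_mul, conjTranspose_conjTranspose]
    calc Vᴴ * (Mᴴ * V) * (Vᴴ * M * V) = Vᴴ * (Mᴴ * (V * Vᴴ) * M) * V := by
          simp only [mul_assoc]
      _ = 1 := by rw [hVV', mul_one, hMM, mul_one, hVV]
  have hnorm : ∀ i, ‖z i‖ = 1 := by
    intro i
    have := congrFun (congrFun hDD i) i
    rw [diagonal_conjTranspose, diagonal_mul_diagonal, diagonal_apply_eq, one_apply_eq,
      Pi.star_apply, Complex.star_def, ← Complex.normSq_eq_conj_mul_self] at this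
    have h' : Complex.normSq (z i) = 1 := by exact_mod_cast this
    rw [Complex.normSq_eq_norm_sq] at h'
    exact (pow_eq_one_iff_of_nonneg (norm_nonneg _) two_ne_zero).1 h'
  rw [numericalRange_eq_convexHull hV hMV]
  have hsub : convexHull ℝ (z '' Set.univ) ⊆ Metric.closedBall 0 1 := by
    refine convexHull_min ?_ (convex_closedBall _ _)
    rintro _ ⟨i, -, rfl⟩
    simp [hnorm i]
  refine inter_extremePoints_subset_extremePoints_of_subset hsub
    ⟨subset_convexHull _ _ ⟨j, Set.mem_univ j, rfl⟩, ?_⟩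
  exact StrictConvexSpace.sphere_subset_extremePoints_closedBall 0 one_ne_zero
    (mem_sphere_zero_iff_norm.2 (hnorm j))

end Diagonalized

end NormalCompression

theorem proposition15 (N : ℕ) (M : Matrix (Fin N) (Fin N) ℂ) (hM : IsStarNormal M)
    (z : Fin N → ℂ) (hz : M.charpoly.roots = Finset.univ.val.map z)
    (hdistinct : Function.Injective z) :
    ((∀ j, z j ∈ (NormalCompression.numericalRange M).extremePoints ℝ) →
      ∀ a ∈ NormalCompression.rankNumericalRange 2 M,
      ∀ b ∈ NormalCompression.rankNumericalRange 2 M,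
        NormalCompression.IsCompression !![a, 0; 0, b] M) ∧
    (M ∈ Matrix.unitaryGroup (Fin N) ℂ →
      ∀ j, z j ∈ (NormalCompression.numericalRange M).extremePoints ℝ) := by
  open NormalCompression in
  obtain ⟨V, hV, hMV⟩ := exists_unitary_diagonalization hM hz hdistinct
  refine ⟨fun hext a ha b hb => ?_, mem_extremePoints_of_unitary hV hMV⟩
  have hN := two_le_of_mem_rankNumericalRange ha
  exact isCompression_of_diagCompression hV hMV hN (diagCompression_of_deep (by omega)
    (fun j => not_mem_convexHull_of_mem_extremePoints hV hMV hdistinct (hext j))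
    (deep_of_mem_rankNumericalRange hV hMV ha) (deep_of_mem_rankNumericalRange hV hMV hb))
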